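/- Let $s>1$, $C>0$, and let $V:\mathbb R\to\mathbb R$ be measurable with $V(x)\ge C^{-1}|x|^s$. Let $h=-\partial_x^2+V$ be the self-adjoint operator on $L^2(\mathbb R;\mathbb C)$ associated with the quadratic form $f\mapsto\int|f'|^2+\int V|f|^2$ on $\{f\in H^1(\mathbb R):\int V|f|^2<\infty\}$ (assumed dense in $L^2(\mathbb R)$, as is the case for $V\in L^1_{\rm loc}(\mathbb R)$), with spectral decomposition $h=\sum_{n\ge0}\lambda_n|u_n\rangle\langle u_n|$, where $(u_n)_{n\ge 0}$ is an orthonormal basis of $L^2(\mathbb R)$ and $h u_n=\lambda_n u_n$. Let $\mu_0$ be the associated Gaussian measure, i.e. the unique probability measure on the formal series $u=\sum_n\alpha_nu_n$, identified with their coefficient sequences $(\alpha_n)\in\mathbb C^{\mathbb N}$ (with the cylinder $\sigma$-algebra), whose projection on the coefficients $(\alpha_0,\dots,\alpha_K)$ is, for every $K$, $$\bigotimes_{j=0}^K\frac{\lambda_j}{\pi}e^{-\lambda_j|\alpha_j|^2}\,d\alpha_j,\qquad d\alpha_j=d\,\mathrm{Re}\,\alpha_j\,d\,\mathrm{Im}\,\alpha_j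 .$$ Then: 1. For every $r$ with $\max(2,4/s)<r<\infty$, the measure $\mu_0$ is supported on $L^r(\mathbb R)$: for $\mu_0$-almost every $u=\sum_n\alpha_nu_n$ there is exactly one function in $L^r(\mathbb R)$, again denoted $u$, such that $\int_{\mathbb R}\overline{u_n}\,u\,dx=\alpha_n$ for all $n$. Moreover, there exists $\alpha_r>0$ such that $$\int e^{\alpha_r\|u\|_{L^r(\mathbb R)}^2}\,d\mu_0(u)<\infty .$$ 2. The diagonal $x\mapsto h^{-1}(x;x)=\sum_{n\ge0}\lambda_n^{-1}|u_n(x)|^2$ of the kernel of $h^{-1}$ belongs to $L^p(\mathbb R)$ for every $\max(1,2/s)<p\le\infty$. -/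

import Mathlib

open MeasureTheory
open scoped ContDiff ENNReal ComplexConjugate

noncomputable section

namespace FreeGibbs

/-- The one-particle space `L²(ℝ; ℂ)`. -/
abbrev L2 : Type := Lp ℂ 2 (volume : Measure ℝ)

/-- `g` is the weak derivative of `f` on `ℝ`. -/
def HasWeakDeriv (f g : ℝ → ℂ) : Prop :=
  ∀ φ : ℝ → ℂ, ContDiff ℝ ∞ φ → HasCompactSupport φ →
    ∫ x, deriv φ x * f x = -∫ x, φ x * g x

/-- `f` lies in the form domain `{f ∈ H¹(ℝ) : ∫ V |f|² < ∞}` of `-∂ₓ² + V`, and `f'` is its weak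
derivative. -/
structure MemFormDomain (V : ℝ → ℝ) (f f' : L2) : Prop where
  weakDeriv : HasWeakDeriv f f'
  potential : Integrable fun x => V x * ‖f x‖ ^ 2

/-- `f` lies in the domain of the operator `h = -∂ₓ² + V` on `L²(ℝ)` and `h f = g`, where `h` is
the operator associated with the quadratic form `f ↦ ∫ |f'|² + ∫ V |f|²`. -/
def SchrodingerApply (V : ℝ → ℝ) (f g : L2) : Prop :=
  ∃ f' : L2, MemFormDomain V f f' ∧ ∀ φ φ' : L2, MemFormDomain V φ φ' →
    (∫ x, conj (φ' x) * f' x) + (∫ x, (V x : ℂ) * (conj (φ x) * f x)) = ∫ x, conj (φ x) * g x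

/-- The spectral decomposition `h = ∑ₙ λₙ |uₙ⟩⟨uₙ|`: the `uₙ` form an orthonormal basis of `L²(ℝ)`
and `h uₙ = λₙ uₙ`. -/
def IsSpectralDecomposition (V : ℝ → ℝ) (lam : ℕ → ℝ) (u : HilbertBasis ℕ ℂ L2) : Prop :=
  ∀ n, SchrodingerApply V (u n) ((lam n : ℂ) • u n)

/-- The measure `(l / π) exp (-l |z|²) da db` on `ℂ`, `z = a + i b`. -/
def complexGaussian (l : ℝ) : Measure ℂ :=
  volume.withDensity fun z => ENNReal.ofReal (l / Real.pi * Real.exp (-l * ‖z‖ ^ 2))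

/-- `μ` is the Gaussian measure with cylindrical projections
`⊗_{j ≤ K} (λⱼ / π) exp (-λⱼ |αⱼ|²) dαⱼ`. A formal series `∑ₙ αₙ uₙ` is identified with its
coefficient sequence `α`, and `ℕ → ℂ` carries the cylinder σ-algebra. -/
structure IsFreeGibbsMeasure (lam : ℕ → ℝ) (μ : Measure (ℕ → ℂ)) : Prop where
  isProb : IsProbabilityMeasure μ
  proj : ∀ K : ℕ, μ.map (fun (α : ℕ → ℂ) (j : Fin (K + 1)) => α j) =
    Measure.pi fun j : Fin (K + 1) => complexGaussian (lam j)

/-- The function `f` has coefficients `⟨uₙ, f⟩ = αₙ`, i.e. it is the function represented by the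
formal series `∑ₙ αₙ uₙ`. -/
def HasCoeffs (u : HilbertBasis ℕ ℂ L2) (f : ℝ → ℂ) (α : ℕ → ℂ) : Prop :=
  ∀ n, Integrable (fun x => conj (u n x) * f x) ∧ ∫ x, conj (u n x) * f x = α n

open Classical in
/-- The element of `L^r(ℝ)` represented by `∑ₙ αₙ uₙ` (and `0` if there is none). -/
def toLr (u : HilbertBasis ℕ ℂ L2) (r : ℝ) (α : ℕ → ℂ) :
    Lp ℂ (ENNReal.ofReal r) (volume : Measure ℝ) :=
  if h : ∃ f : Lp ℂ (ENNReal.ofReal r) (volume : Measure ℝ), HasCoeffs u f α then h.choose else 0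

/-- The diagonal `h⁻¹(x; x) = ∑ₙ λₙ⁻¹ |uₙ(x)|²` of the kernel of `h⁻¹`. -/
def greenDiag (lam : ℕ → ℝ) (u : HilbertBasis ℕ ℂ L2) (x : ℝ) : ℝ≥0∞ :=
  ∑' n, ENNReal.ofReal (‖u n x‖ ^ 2 / lam n)

theorem isProbabilityMeasure_complexGaussian {l : ℝ} (hl : 0 < l) :
    IsProbabilityMeasure (complexGaussian l) := by
  have h1 : ∫ z : ℂ, Real.exp (-l * ‖z‖ ^ 2) = Real.pi / l := by
    have := GaussianFourier.integral_rexp_neg_mul_sq_norm (V := ℂ) hl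
    rw [this, Complex.finrank_real_complex]
    norm_num
  have h2 : Integrable fun z : ℂ => Real.exp (-l * ‖z‖ ^ 2) := by
    by_contra h
    rw [integral_undef h] at h1
    have := div_pos Real.pi_pos hl
    linarith
  constructor
  rw [complexGaussian, withDensity_apply _ MeasurableSet.univ, Measure.restrict_univ,
    ← ofReal_integral_eq_lintegral_ofReal (h2.const_mul _)
      (Filter.Eventually.of_forall fun z => by have := Real.pi_pos; positivity),
    integral_const_mul, h1]
  have := Real.pi_pos
  rw [show l / Real.pi * (Real.pi / l) = 1 by field_simp]
  simp

/-- The Gaussian measure exists. -/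
theorem exists_isFreeGibbsMeasure {lam : ℕ → ℝ} (hlam : ∀ n, 0 < lam n) :
    ∃ μ, IsFreeGibbsMeasure lam μ := by
  have : ∀ n, IsProbabilityMeasure (complexGaussian (lam n)) := fun n =>
    isProbabilityMeasure_complexGaussian (hlam n)
  refine ⟨Measure.infinitePi fun n => complexGaussian (lam n), inferInstance, fun K => ?_⟩
  symm
  refine Measure.pi_eq fun t ht => ?_
  have hm : Measurable (fun (α : ℕ → ℂ) (j : Fin (K + 1)) => α j) := by fun_prop
  rw [Measure.map_apply hm (MeasurableSet.univ_pi ht)]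
  have key := Measure.infinitePi_pi (fun n => complexGaussian (lam n))
    (s := Finset.range (K + 1))
    (t := fun n => if h : n < K + 1 then t ⟨n, h⟩ else Set.univ)
    (fun n hn => by
      simp only [Finset.mem_range.mp hn, dite_true]
      exact ht _)
  rw [Finset.prod_range] at key
  simp only [Fin.is_lt, dite_true, Fin.eta] at key
  rw [← key]
  congr 1
  ext α
  simp only [Set.mem_preimage, Set.mem_pi, Set.mem_univ, true_imp_iff, Finset.coe_range,
    Set.mem_Iio]
  constructor
  · intro h n hn
    simpa [hn] using h ⟨n, hn⟩
  · intro h j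
    have := h j j.2
    rwa [dif_pos j.2] at this

end FreeGibbs

end

noncomputable section

namespace FreeGibbs

open scoped InnerProductSpace

/-! In terms of the energy vectors `e n = (uₙ', √V uₙ)` the quadratic form is an inner product, and
the eigenvalue equation says that the `e n` are orthogonal with squared norms `λₙ`. Everything rests
on one deterministic estimate: a function of energy `E` satisfies `|f(x)|² ≤ K(x) E`, where `K(x)`
is of order `(1 + |x|) ^ (-s / 2)` (`norm_sq_le_envelope`). The truncated Green function with pole
at `x` has value at `x` and energy both equal to the partial sum of `∑ |uₙ(x)|² / λₙ`, so the
estimate gives `h⁻¹(x;x) ≤ K(x)` (`IsEigenSystem.ae_sum_le_envelope`). Since `K ∈ L^p` for `p > 2 /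
s`, this settles the diagonal.

For the Gaussian measure write `r = 2p`. At fixed `x` a partial sum of `∑ uₙ(x) αₙ` is Gaussian with
variance at most `K(x)`. Its moments bound the `L^{2p}` norms of blocks of the series by `L^p` norms
of tails of the diagonal, which vanish by dominated convergence, so a subsequence converges almost
surely. For exponential moments, `exp_eLpNorm_sq_le` bounds `exp (a ‖f‖²)` by a multiple of `1 + ∫
exp (|f|² / 2K) K^p`. The expectation of the latter is bounded uniformly over partial sums, and
Fatou's lemma passes to the limit.

Uniqueness is not completeness in `L²`, because an `L^r` function need not be in `L²`. The condition
`s > 1` embeds the form domain in `L¹`, hence in `L^q` with `q` conjugate to `r`, and eigenfunction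
expansions of form domain elements converge there. A function `d ∈ L^r` with zero coefficients is
therefore orthogonal to the form domain, in particular to every `χ uₙ` with `χ` a test function.
Hence `conj uₙ · d = 0` almost everywhere, and the `uₙ` have no common zeros
(`IsEigenSystem.ae_eq_zero`). -/

/-! ### Weak derivatives on the line. -/

/-- Integration by parts against a test function, for the primitive of a locally integrable
function. -/
theorem integral_deriv_mul_primitive {g : ℝ → ℝ} (hg : LocallyIntegrable g) {φ : ℝ → ℝ}
    (hφ : ContDiff ℝ ∞ φ) (hφc : HasCompactSupport φ) :
    ∫ x, deriv φ x * ∫ t in (0 : ℝ)..x, g t = -∫ x, φ x * g x := by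
  obtain ⟨R, hR⟩ := hφc.isCompact.isBounded.subset_ball (0 : ℝ)
  set b := max R 1 with hb
  have hb0 : (0 : ℝ) < b := by positivity
  have hsub : tsupport φ ⊆ Set.Ioo (-b) b := by
    intro x hx
    have := hR hx
    rw [mem_ball_zero_iff, Real.norm_eq_abs, abs_lt] at this
    exact ⟨by linarith [le_max_left R 1], by linarith [le_max_left R 1]⟩
  have hz : ∀ x, x ∉ Set.Ioo (-b) b → φ x = 0 := fun x hx =>
    image_eq_zero_of_notMem_tsupport fun h => hx (hsub h)
  have hz' : ∀ x, x ∉ Set.Ioo (-b) b → deriv φ x = 0 := fun x hx =>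
    image_eq_zero_of_notMem_tsupport fun h => hx (hsub (tsupport_deriv_subset h))
  have hI : IntervalIntegrable g volume (-b) b :=
    (hg.integrableOn_isCompact isCompact_uIcc).intervalIntegrable
  have h0 : (0 : ℝ) ∈ Set.uIcc (-b) b := by
    rw [Set.uIcc_of_le (by linarith)]; constructor <;> linarith
  -- The primitive need not be differentiable everywhere; absolute continuity is what justifies the
  -- integration by parts.
  have hac := hI.absolutelyContinuousOnInterval_intervalIntegral h0
  have hφac : AbsolutelyContinuousOnInterval φ (-b) b :=
    ((hφ.of_le (by simp)).contDiffOn).absolutelyContinuousOnInterval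
  have key := hac.integral_mul_deriv_eq_deriv_mul hφac
  rw [hz b (by simp), hz (-b) (by simp)] at key
  have h1 : ∫ x, deriv φ x * ∫ t in (0 : ℝ)..x, g t
      = ∫ x in (-b)..b, (∫ t in (0 : ℝ)..x, g t) * deriv φ x := by
    rw [intervalIntegral.integral_of_le (by linarith), ← integral_indicator measurableSet_Ioc]
    congr 1; ext x
    by_cases hx : x ∈ Set.Ioc (-b) b
    · rw [Set.indicator_of_mem hx, mul_comm]
    · rw [Set.indicator_of_notMem hx, hz' x (fun h => hx ⟨h.1, h.2.le⟩), zero_mul]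
  have h2 : ∫ x, φ x * g x = ∫ x in (-b)..b, deriv (fun x => ∫ t in (0 : ℝ)..x, g t) x * φ x := by
    rw [intervalIntegral.integral_of_le (by linarith), ← integral_indicator measurableSet_Ioc]
    apply integral_congr_ae
    filter_upwards [hI.ae_hasDerivAt_integral] with x hx
    by_cases hm : x ∈ Set.Ioc (-b) b
    · rw [Set.indicator_of_mem hm, (hx (by
        rw [Set.uIcc_of_le (by linarith)]; exact ⟨hm.1.le, hm.2⟩) 0 h0).deriv, mul_comm]
    · rw [Set.indicator_of_notMem hm, hz x (fun h => hm ⟨h.1, h.2.le⟩), zero_mul]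
  rw [h1, key, h2]; simp

/-- A test function of vanishing integral is the derivative of a test function. -/
theorem exists_primitive_testFunction {ψ : ℝ → ℝ} (hψ : ContDiff ℝ ∞ ψ)
    (hψc : HasCompactSupport ψ) (h0 : ∫ x, ψ x = 0) :
    ∃ φ : ℝ → ℝ, ContDiff ℝ ∞ φ ∧ HasCompactSupport φ ∧ deriv φ = ψ := by
  obtain ⟨R, hR⟩ := hψc.isCompact.isBounded.subset_ball (0 : ℝ)
  set b := max R 1 with hb
  have hb0 : (0 : ℝ) < b := by positivity
  have hz : ∀ x, x ∉ Set.Ioo (-b) b → ψ x = 0 := fun x hx =>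
    image_eq_zero_of_notMem_tsupport fun h => hx (by
      have := hR h
      rw [mem_ball_zero_iff, Real.norm_eq_abs, abs_lt] at this
      exact ⟨by linarith [le_max_left R 1], by linarith [le_max_left R 1]⟩)
  have hd : ∀ x, HasDerivAt (fun x => ∫ t in (-b)..x, ψ t) (ψ x) x := fun x =>
    hψ.continuous.integral_hasStrictDerivAt _ _ |>.hasDerivAt
  have hderiv : deriv (fun x => ∫ t in (-b)..x, ψ t) = ψ := funext fun x => (hd x).deriv
  refine ⟨fun x => ∫ t in (-b)..x, ψ t, ?_, ?_, hderiv⟩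
  · rw [contDiff_infty_iff_deriv, hderiv]
    exact ⟨fun x => (hd x).differentiableAt, hψ⟩
  · refine HasCompactSupport.intro (isCompact_Icc (a := -b) (b := b)) fun x hx => ?_
    rcases lt_or_ge x (-b) with h | h
    · rw [intervalIntegral.integral_symm, neg_eq_zero]
      rw [intervalIntegral.integral_of_le h.le]
      refine setIntegral_eq_zero_of_forall_eq_zero fun t ht => hz t fun h' => ?_
      linarith [ht.2, h'.1]
    · have hxb : b < x := by
        by_contra h'
        exact hx ⟨h, not_lt.mp h'⟩
      -- To the right of the support the primitive is the full integral, which vanishes.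
      rw [intervalIntegral.integral_of_le h, setIntegral_eq_integral_of_forall_compl_eq_zero, h0]
      intro t ht
      exact hz t fun h' => ht ⟨h'.1, (h'.2.trans hxb).le⟩

/-- A locally integrable function with locally integrable weak derivative is almost everywhere the
primitive of the latter, up to a constant. -/
theorem ae_eq_const_add_primitive {f g : ℝ → ℝ} (hf : LocallyIntegrable f)
    (hg : LocallyIntegrable g)
    (h : ∀ φ : ℝ → ℝ, ContDiff ℝ ∞ φ → HasCompactSupport φ →
      ∫ x, deriv φ x * f x = -∫ x, φ x * g x) :
    ∃ c : ℝ, ∀ᵐ x, f x = c + ∫ t in (0 : ℝ)..x, g t := by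
  have hGc : Continuous fun x => ∫ t in (0 : ℝ)..x, g t :=
    intervalIntegral.continuous_primitive
      (fun a b => (hg.integrableOn_isCompact isCompact_uIcc).intervalIntegrable) 0
  have hG : LocallyIntegrable fun x => ∫ t in (0 : ℝ)..x, g t := hGc.locallyIntegrable
  have hint : ∀ {φ f : ℝ → ℝ}, ContDiff ℝ ∞ φ → HasCompactSupport φ → LocallyIntegrable f →
      Integrable fun x => φ x * f x := fun hφ hφc hf => by
    simpa using hf.integrable_smul_left_of_hasCompactSupport hφ.continuous hφc
  have hdiff : ∀ {φ : ℝ → ℝ}, ContDiff ℝ ∞ φ → ContDiff ℝ ∞ (deriv φ) := fun hφ =>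
    (contDiff_infty_iff_deriv.mp hφ).2
  have hzero : ∀ φ : ℝ → ℝ, ContDiff ℝ ∞ φ → HasCompactSupport φ →
      ∫ x, deriv φ x * (f x - ∫ t in (0 : ℝ)..x, g t) = 0 := fun φ hφ hφc => by
    simp_rw [mul_sub]
    rw [integral_sub (hint (hdiff hφ) hφc.deriv hf) (hint (hdiff hφ) hφc.deriv hG), h φ hφ hφc,
      integral_deriv_mul_primitive hg hφ hφc, sub_self]
  have hHl : LocallyIntegrable fun x => f x - ∫ t in (0 : ℝ)..x, g t := hf.sub hG
  let B : ContDiffBump (0 : ℝ) := ⟨1, 2, by norm_num, by norm_num⟩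
  let ρ : ℝ → ℝ := B.normed volume
  have hρ : ContDiff ℝ ∞ ρ := B.contDiff_normed
  have hρc : HasCompactSupport ρ := B.hasCompactSupport_normed
  have hρ1 : ∫ x, ρ x = 1 := B.integral_normed
  set c := ∫ x, ρ x * (f x - ∫ t in (0 : ℝ)..x, g t) with hc
  refine ⟨c, ?_⟩
  have := ae_eq_of_integral_contDiff_smul_eq (f' := fun _ => c) hHl
    (locallyIntegrable_const c) (fun ψ hψ hψc => ?_)
  · filter_upwards [this] with x hx
    linarith
  have hψi : Integrable ψ := hψ.continuous.integrable_of_hasCompactSupport hψc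
  have hρi : Integrable ρ := hρ.continuous.integrable_of_hasCompactSupport hρc
  -- Subtracting `(∫ ψ) ρ` makes the mean zero, so the result is a derivative and is annihilated by
  -- `f - ∫ g`. Thus `f - ∫ g` acts on `ψ` as the constant `c`.
  obtain ⟨φ, hφ, hφc, hφd⟩ := exists_primitive_testFunction
    (ψ := fun x => ψ x - (∫ y, ψ y) * ρ x) (hψ.sub (contDiff_const.mul hρ))
    (hψc.sub hρc.mul_left) (by
      rw [integral_sub hψi (hρi.const_mul _), integral_const_mul, hρ1]; ring)
  have h1 := hzero φ hφ hφc
  rw [hφd] at h1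
  simp only [smul_eq_mul]
  simp_rw [sub_mul, mul_assoc] at h1
  rw [integral_sub (hint hψ hψc hHl) ((hint hρ hρc hHl).const_mul _), integral_const_mul,
    ← hc] at h1
  rw [integral_mul_const]
  linarith

/-- A function in `H¹(ℝ)` has a representative which is a primitive of the weak derivative. -/
theorem HasWeakDeriv.exists_primitive {f g : ℝ → ℂ} (hf : LocallyIntegrable f)
    (hg : LocallyIntegrable g) (h : HasWeakDeriv f g) :
    ∃ F : ℝ → ℂ, F =ᵐ[volume] f ∧ ∀ x y, F y - F x = ∫ t in x..y, g t := by
  have hint : ∀ {φ : ℝ → ℝ} {f : ℝ → ℂ}, ContDiff ℝ ∞ φ → HasCompactSupport φ →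
      LocallyIntegrable f → Integrable fun x => (φ x : ℂ) * f x := fun hφ hφc hf => by
    simpa using hf.integrable_smul_left_of_hasCompactSupport hφ.continuous hφc
  have key : ∀ φ : ℝ → ℝ, ContDiff ℝ ∞ φ → HasCompactSupport φ →
      ∫ x, ((deriv φ x : ℝ) : ℂ) * f x = -∫ x, (φ x : ℂ) * g x := fun φ hφ hφc => by
    have := h (fun x => (φ x : ℂ)) (Complex.ofRealCLM.contDiff.comp hφ)
      (hφc.comp_left (g := fun x : ℝ => (x : ℂ)) (by simp))
    rw [← this]
    congr 1; ext x
    rw [((hφ.differentiable (by simp) x).hasDerivAt.ofReal_comp).deriv]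
  have hdiff : ∀ {φ : ℝ → ℝ}, ContDiff ℝ ∞ φ → ContDiff ℝ ∞ (deriv φ) := fun hφ =>
    (contDiff_infty_iff_deriv.mp hφ).2
  have hcl : ∀ T : ℂ →L[ℝ] ℝ, ∃ c : ℝ, ∀ᵐ x, T (f x) = c + ∫ t in (0 : ℝ)..x, T (g t) := by
    intro T
    have hTl : ∀ {f : ℝ → ℂ}, LocallyIntegrable f → LocallyIntegrable fun x => T (f x) :=
      fun hf x => by
        obtain ⟨U, hU, hi⟩ := hf x
        exact ⟨U, hU, T.integrable_comp hi⟩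
    refine ae_eq_const_add_primitive (hTl hf) (hTl hg) fun φ hφ hφc => ?_
    have hk := congrArg T (key φ hφ hφc)
    rw [map_neg, ← T.integral_comp_comm (hint (hdiff hφ) hφc.deriv hf),
      ← T.integral_comp_comm (hint hφ hφc hg)] at hk
    simpa only [← Complex.real_smul, map_smul, smul_eq_mul] using hk
  obtain ⟨c, hc⟩ := hcl Complex.reCLM
  obtain ⟨d, hd⟩ := hcl Complex.imCLM
  have hgi : ∀ a b, IntervalIntegrable g volume a b := fun a b =>
    (hg.integrableOn_isCompact isCompact_uIcc).intervalIntegrable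
  refine ⟨fun x => (c + d * Complex.I) + ∫ t in (0 : ℝ)..x, g t, ?_, fun x y => ?_⟩
  · filter_upwards [hc, hd] with x hx hy
    rw [Complex.reCLM.intervalIntegral_comp_comm (hgi _ _)] at hx
    rw [Complex.imCLM.intervalIntegral_comp_comm (hgi _ _)] at hy
    apply Complex.ext
    · simpa using hx.symm
    · simpa using hy.symm
  · rw [add_sub_add_left_eq_sub,
      intervalIntegral.integral_interval_sub_left (hgi _ _) (hgi _ _)]

/-! ### The form domain as a graph over `L²`. -/

/-- The Hilbert space `L² ⊕ L²`, in which the form of `-∂ₓ² + V` is the squared norm of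
`(f', √V f)`. -/
abbrev EnergySpace : Type := WithLp 2 (L2 × L2)

theorem locallyIntegrable_coe (f : L2) : LocallyIntegrable (f : ℝ → ℂ) :=
  (Lp.memLp f).locallyIntegrable (by norm_num)

theorem integrable_testFunction_mul {φ : ℝ → ℂ} (hφ : ContDiff ℝ ∞ φ) (hφc : HasCompactSupport φ)
    {f : ℝ → ℂ} (hf : LocallyIntegrable f) : Integrable fun x => φ x * f x := by
  simpa using hf.integrable_smul_left_of_hasCompactSupport hφ.continuous hφc

theorem integrable_deriv_testFunction_mul {φ : ℝ → ℂ} (hφ : ContDiff ℝ ∞ φ)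
    (hφc : HasCompactSupport φ) {f : ℝ → ℂ} (hf : LocallyIntegrable f) :
    Integrable fun x => deriv φ x * f x :=
  integrable_testFunction_mul (contDiff_infty_iff_deriv.mp hφ).2 hφc.deriv hf

theorem HasWeakDeriv.congr {f g f₁ g₁ : ℝ → ℂ} (h : HasWeakDeriv f g) (hf : f₁ =ᵐ[volume] f)
    (hg : g₁ =ᵐ[volume] g) : HasWeakDeriv f₁ g₁ := fun φ hφ hφc => by
  have h1 : ∫ x, deriv φ x * f₁ x = ∫ x, deriv φ x * f x :=
    integral_congr_ae (by filter_upwards [hf] with x hx; rw [hx])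
  have h2 : ∫ x, φ x * g₁ x = ∫ x, φ x * g x :=
    integral_congr_ae (by filter_upwards [hg] with x hx; rw [hx])
  rw [h1, h2, h φ hφ hφc]

/-- The graph of `f ↦ (f', √V f)` on the form domain of `-∂ₓ² + V`. -/
def energyGraph (V : ℝ → ℝ) : Submodule ℂ (L2 × EnergySpace) where
  carrier := {p | HasWeakDeriv p.1 p.2.fst ∧
    (p.2.snd : ℝ → ℂ) =ᵐ[volume] fun x => (√(V x) : ℂ) * p.1 x}
  zero_mem' := by
    refine ⟨?_, ?_⟩
    · have : HasWeakDeriv 0 0 := fun φ _ _ => by simp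
      exact this.congr (Lp.coeFn_zero _ _ _) (Lp.coeFn_zero _ _ _)
    · filter_upwards [Lp.coeFn_zero ℂ 2 (volume : Measure ℝ)] with x hx
      simp
  add_mem' := by
    rintro ⟨f, e⟩ ⟨g, e'⟩ ⟨h1, h2⟩ ⟨h3, h4⟩
    refine ⟨?_, ?_⟩
    · have : HasWeakDeriv ((f : ℝ → ℂ) + g) ((e.fst : ℝ → ℂ) + e'.fst) := fun φ hφ hφc => by
        simp only [Pi.add_apply, mul_add]
        rw [integral_add (integrable_deriv_testFunction_mul hφ hφc (locallyIntegrable_coe _))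
            (integrable_deriv_testFunction_mul hφ hφc (locallyIntegrable_coe _)),
          integral_add (integrable_testFunction_mul hφ hφc (locallyIntegrable_coe _))
            (integrable_testFunction_mul hφ hφc (locallyIntegrable_coe _)), neg_add]
        congr 1
        · exact h1 φ hφ hφc
        · exact h3 φ hφ hφc
      exact this.congr (Lp.coeFn_add _ _) (Lp.coeFn_add _ _)
    · filter_upwards [h2, h4, Lp.coeFn_add f g, Lp.coeFn_add e.snd e'.snd] with x a b c d
      simp only [Prod.mk_add_mk, WithLp.add_snd]
      rw [d, c, Pi.add_apply, Pi.add_apply, a, b, mul_add]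
  smul_mem' := by
    rintro c ⟨f, e⟩ ⟨h1, h2⟩
    refine ⟨?_, ?_⟩
    · have : HasWeakDeriv (c • (f : ℝ → ℂ)) (c • (e.fst : ℝ → ℂ)) := fun φ hφ hφc => by
        simp only [Pi.smul_apply, smul_eq_mul, mul_left_comm _ c]
        rw [integral_const_mul, integral_const_mul, h1 φ hφ hφc, mul_neg]
      exact this.congr (Lp.coeFn_smul _ _) (Lp.coeFn_smul _ _)
    · filter_upwards [h2, Lp.coeFn_smul c f, Lp.coeFn_smul c e.snd] with x a b d
      simp only [Prod.smul_mk, WithLp.smul_snd]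
      rw [d, b, Pi.smul_apply, Pi.smul_apply, a, smul_eq_mul, smul_eq_mul, mul_left_comm]

theorem MemFormDomain.exists_energyGraph {V : ℝ → ℝ} (hVm : AEMeasurable V volume)
    (hV0 : ∀ᵐ x, 0 ≤ V x) {f f' : L2} (h : MemFormDomain V f f') :
    ∃ e : EnergySpace, e.fst = f' ∧ (f, e) ∈ energyGraph V := by
  have hm : AEStronglyMeasurable (fun x => (√(V x) : ℂ) * f x) volume :=
    ((Complex.measurable_ofReal.comp_aemeasurable
      (Real.continuous_sqrt.measurable.comp_aemeasurable hVm)).aestronglyMeasurable).mul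
      (Lp.aestronglyMeasurable f)
  have hk : MemLp (fun x => (√(V x) : ℂ) * f x) 2 volume := by
    rw [memLp_two_iff_integrable_sq_norm hm]
    refine h.potential.congr ?_
    filter_upwards [hV0] with x hx
    rw [norm_mul, mul_pow, Complex.norm_real, Real.norm_eq_abs, sq_abs, Real.sq_sqrt hx]
  exact ⟨WithLp.toLp 2 (f', hk.toLp _), rfl, h.weakDeriv, hk.coeFn_toLp⟩

theorem memFormDomain_of_mem_energyGraph {V : ℝ → ℝ}
    (hV0 : ∀ᵐ x, 0 ≤ V x) {f : L2} {e : EnergySpace} (h : (f, e) ∈ energyGraph V) :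
    MemFormDomain V f e.fst := by
  refine ⟨h.1, ?_⟩
  have := (memLp_two_iff_integrable_sq_norm (Lp.aestronglyMeasurable e.snd)).mp (Lp.memLp e.snd)
  refine this.congr ?_
  filter_upwards [hV0, h.2] with x hx hk
  rw [hk]
  simp only [norm_mul, mul_pow, Complex.norm_real, Real.norm_eq_abs, sq_abs, Real.sq_sqrt hx]

/-- The quadratic form of `-∂ₓ² + V` as an inner product. -/
theorem inner_eq_form {V : ℝ → ℝ} (hV0 : ∀ᵐ x, 0 ≤ V x) {f φ : L2} {e η : EnergySpace}
    (h : (f, e) ∈ energyGraph V) (h' : (φ, η) ∈ energyGraph V) :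
    ⟪η, e⟫_ℂ = (∫ x, conj (η.fst x) * e.fst x) + ∫ x, (V x : ℂ) * (conj (φ x) * f x) := by
  rw [WithLp.prod_inner_apply]
  congr 1
  · rw [L2.inner_def]
    simp_rw [RCLike.inner_apply']
    rfl
  · rw [L2.inner_def]
    apply integral_congr_ae
    filter_upwards [hV0, h.2, h'.2] with x hx hk hk'
    rw [RCLike.inner_apply']
    change conj (η.snd x) * e.snd x = _
    rw [hk, hk', map_mul, Complex.conj_ofReal]
    have : ((√(V x) : ℝ) : ℂ) * (√(V x) : ℝ) = V x := by
      rw [← Complex.ofReal_mul, Real.mul_self_sqrt hx]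
    rw [← this]; ring

/-- Converts the weak formulation of `h f = g` into Hilbert space geometry, the only form in which
the operator is used afterwards. -/
theorem SchrodingerApply.exists_energyGraph {V : ℝ → ℝ} (hVm : AEMeasurable V volume)
    (hV0 : ∀ᵐ x, 0 ≤ V x) {f g : L2} (h : SchrodingerApply V f g) :
    ∃ e : EnergySpace, (f, e) ∈ energyGraph V ∧
      ∀ p ∈ energyGraph V, ⟪p.2, e⟫_ℂ = ⟪p.1, g⟫_ℂ := by
  obtain ⟨f', hf, hform⟩ := h
  obtain ⟨e, rfl, he⟩ := hf.exists_energyGraph hVm hV0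
  refine ⟨e, he, ?_⟩
  rintro ⟨φ, η⟩ hη
  rw [inner_eq_form hV0 he hη, hform φ η.fst (memFormDomain_of_mem_energyGraph hV0 hη),
    L2.inner_def]
  simp_rw [RCLike.inner_apply']

/-! ### Orthogonality of the energy vectors. -/

/-- Energy vectors `eₙ = (uₙ', √V uₙ)` of an orthonormal basis of eigenfunctions. -/
structure IsEigenSystem (V : ℝ → ℝ) (lam : ℕ → ℝ) (u : HilbertBasis ℕ ℂ L2)
    (e : ℕ → EnergySpace) : Prop where
  mem : ∀ n, (u n, e n) ∈ energyGraph V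
  inner_eq : ∀ n, ∀ p ∈ energyGraph V, ⟪p.2, e n⟫_ℂ = lam n * ⟪p.1, u n⟫_ℂ

theorem IsSpectralDecomposition.exists_isEigenSystem {V : ℝ → ℝ} (hVm : AEMeasurable V volume)
    (hV0 : ∀ᵐ x, 0 ≤ V x) {lam : ℕ → ℝ} {u : HilbertBasis ℕ ℂ L2}
    (h : IsSpectralDecomposition V lam u) : ∃ e, IsEigenSystem V lam u e := by
  choose e he h' using fun n => (h n).exists_energyGraph hVm hV0
  refine ⟨e, he, fun n p hp => ?_⟩
  rw [h' n p hp, inner_smul_right]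

namespace IsEigenSystem

variable {V : ℝ → ℝ} {lam : ℕ → ℝ} {u : HilbertBasis ℕ ℂ L2} {e : ℕ → EnergySpace}

theorem sum_mem (h : IsEigenSystem V lam u e) (t : Finset ℕ) (c : ℕ → ℂ) :
    (∑ n ∈ t, c n • u n, ∑ n ∈ t, c n • e n) ∈ energyGraph V := by
  have : (∑ n ∈ t, c n • u n, ∑ n ∈ t, c n • e n) = ∑ n ∈ t, c n • (u n, e n) := by
    simp [Prod.ext_iff, Prod.fst_sum, Prod.snd_sum]
  rw [this]
  exact Submodule.sum_mem _ fun n _ => Submodule.smul_mem _ _ (h.mem n)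

theorem inner_sum (h : IsEigenSystem V lam u e) (t : Finset ℕ) (c : ℕ → ℂ) {p : L2 × EnergySpace}
    (hp : p ∈ energyGraph V) :
    ⟪p.2, ∑ n ∈ t, c n • e n⟫_ℂ = ∑ n ∈ t, c n * (lam n * ⟪p.1, u n⟫_ℂ) := by
  rw [_root_.inner_sum]
  refine Finset.sum_congr rfl fun n _ => ?_
  rw [inner_smul_right, h.inner_eq n p hp]

/-- Pythagoras for the energy vectors: the eigenvalue relation is tested against the sum itself, and
orthonormality of the `u n` removes the cross terms. -/
theorem norm_sum_sq (h : IsEigenSystem V lam u e) (t : Finset ℕ) (c : ℕ → ℂ) :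
    ‖∑ n ∈ t, c n • e n‖ ^ 2 = ∑ n ∈ t, lam n * ‖c n‖ ^ 2 := by
  have h1 := h.inner_sum t c (h.sum_mem t c)
  rw [inner_self_eq_norm_sq_to_K] at h1
  have h2 : ∀ n ∈ t, ⟪∑ m ∈ t, c m • u m, u n⟫_ℂ = conj (c n) := fun n hn =>
    u.orthonormal.inner_left_sum c hn
  apply Complex.ofReal_injective
  push_cast
  refine h1.trans (Finset.sum_congr rfl fun n hn => ?_)
  rw [h2 n hn, ← Complex.mul_conj']
  ring

/-- The eigenvalue is `‖e n‖ ^ 2`, and a vanishing energy vector would give `√V uₙ = 0`, hence `uₙ =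
0`. -/
theorem lam_pos (h : IsEigenSystem V lam u e) (hV : ∀ᵐ x, 0 < V x) (n : ℕ) : 0 < lam n := by
  have h1 := h.norm_sum_sq {n} fun _ => 1
  simp only [Finset.sum_singleton, one_smul, norm_one, one_pow, mul_one] at h1
  have h2 : e n ≠ 0 := fun h0 => by
    have hk := (h.mem n).2
    have : u n = 0 := by
      apply Lp.ext
      filter_upwards [hk, hV, Lp.coeFn_zero ℂ 2 (volume : Measure ℝ)] with x hx hVx hz
      simp only [h0] at hx
      change (0 : L2) x = _ at hx
      rw [hz] at hx ⊢
      have hs : (√(V x) : ℂ) ≠ 0 := by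
        exact_mod_cast (Real.sqrt_pos.mpr hVx).ne'
      simpa [hs] using hx.symm
    have h1 := u.orthonormal.1 n
    rw [this] at h1; simp at h1
  rw [← h1]; positivity

/-- Bessel's inequality in the form domain. -/
theorem norm_sub_sum_le (h : IsEigenSystem V lam u e) (t : Finset ℕ) {p : L2 × EnergySpace}
    (hp : p ∈ energyGraph V) :
    ‖p.2 - ∑ n ∈ t, ⟪u n, p.1⟫_ℂ • e n‖ ≤ ‖p.2‖ := by
  set P := ∑ n ∈ t, ⟪u n, p.1⟫_ℂ • e n with hP
  set w := ∑ n ∈ t, ⟪u n, p.1⟫_ℂ • u n with hw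
  have hmem : (p.1 - w, p.2 - P) ∈ energyGraph V :=
    Submodule.sub_mem _ hp (h.sum_mem t fun n => ⟪u n, p.1⟫_ℂ)
  -- The remainder `p.1 - w` is `L²`-orthogonal to each `u n` with `n ∈ t`, so by the eigenvalue
  -- relation its energy vector is orthogonal to `P`.
  have h0 : ⟪p.2 - P, P⟫_ℂ = 0 := by
    have := h.inner_sum t (fun n => ⟪u n, p.1⟫_ℂ) hmem
    refine this.trans (Finset.sum_eq_zero fun n hn => ?_)
    have h2 : ⟪w, u n⟫_ℂ = conj ⟪u n, p.1⟫_ℂ := u.orthonormal.inner_left_sum _ hn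
    simp only [inner_sub_left, h2, inner_conj_symm, sub_self, mul_zero]
  have h1 := norm_add_sq_eq_norm_sq_add_norm_sq_of_inner_eq_zero _ _ h0
  rw [sub_add_cancel] at h1
  nlinarith [norm_nonneg (p.2 - P), norm_nonneg p.2, norm_nonneg P]

end IsEigenSystem

/-! ### Pointwise decay of functions of finite energy. -/

theorem sq_norm_integral_le (g : L2) (x y : ℝ) :
    ‖∫ t in x..y, g t‖ ^ 2 ≤ |y - x| * ‖g‖ ^ 2 := by
  have hm : MeasurableSet (Set.uIoc x y) := measurableSet_uIoc
  have hfin : volume (Set.uIoc x y) ≠ ⊤ := by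
    simp [Set.uIoc]
  have h1 : ‖∫ t in x..y, g t‖ = ‖⟪indicatorConstLp 2 hm hfin (1 : ℂ), g⟫_ℂ‖ := by
    rw [L2.inner_indicatorConstLp_one, intervalIntegral.norm_intervalIntegral_eq]
  have h2 : ‖indicatorConstLp 2 hm hfin (1 : ℂ)‖ ^ 2 = |y - x| := by
    rw [norm_indicatorConstLp (by norm_num) (by norm_num)]
    simp only [norm_one, one_mul, ENNReal.toReal_ofNat, Measure.real, Real.volume_uIoc]
    rw [ENNReal.toReal_ofReal (abs_nonneg _), ← Real.sqrt_eq_rpow, Real.sq_sqrt (abs_nonneg _)]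
  rw [h1, ← h2, ← mul_pow]
  gcongr
  exact norm_inner_le_norm _ _

/-- The decaying function `x ↦ (2 C + 4) 2 ^ (s / 2) (1 + |x|) ^ (-s / 2)`, which dominates
`|f(x)|²` for `f` of unit energy. -/
def envelope (s C x : ℝ) : ℝ := (2 * C + 4) * 2 ^ (s / 2) * (1 + |x|) ^ (-(s / 2))

theorem envelope_pos {s C : ℝ} (hC : 0 < C) (x : ℝ) : 0 < envelope s C x := by
  unfold envelope
  have : 0 < 1 + |x| := by positivity
  positivity

theorem continuous_envelope (s C : ℝ) : Continuous (envelope s C) := by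
  unfold envelope
  refine continuous_const.mul (Continuous.rpow_const (by fun_prop) fun x => Or.inl ?_)
  positivity

theorem envelope_le {s C : ℝ} (hs : 0 < s) (hC : 0 < C) (x : ℝ) :
    envelope s C x ≤ (2 * C + 4) * 2 ^ (s / 2) := by
  unfold envelope
  have : (1 + |x|) ^ (-(s / 2)) ≤ 1 :=
    Real.rpow_le_one_of_one_le_of_nonpos (by linarith [abs_nonneg x]) (by linarith)
  exact mul_le_of_le_one_right (by positivity) this

theorem integrable_envelope_rpow {s C p : ℝ} (hC : 0 < C) (hp : 1 < s / 2 * p) :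
    Integrable fun x => envelope s C x ^ p := by
  have h : Integrable fun x : ℝ => (1 + ‖x‖) ^ (-(s / 2 * p)) :=
    integrable_one_add_norm (by simpa using hp)
  refine (h.const_mul (((2 * C + 4) * 2 ^ (s / 2)) ^ p)).congr (Filter.Eventually.of_forall ?_)
  intro x
  have : 0 ≤ 1 + |x| := by positivity
  simp only [envelope]
  rw [Real.mul_rpow (x := (2 * C + 4) * 2 ^ (s / 2)) (by positivity) (by positivity),
    ← Real.rpow_mul this, neg_mul, Real.norm_eq_abs]

/-- Averaging a Sobolev-type inequality over an interval on which the potential is large. -/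
theorem norm_sq_mul_le_of_interval {V : ℝ → ℝ} {s C : ℝ} (hs : 0 < s) (hC : 0 < C)
    (hV : ∀ᵐ x : ℝ, C⁻¹ * |x| ^ s ≤ V x) {F : ℝ → ℂ} {e : EnergySpace}
    (hF : ∀ x y, F y - F x = ∫ t in x..y, e.fst t)
    (hk : (e.snd : ℝ → ℂ) =ᵐ[volume] fun x => (√(V x) : ℂ) * F x)
    {x a m δ : ℝ} (hm : 0 < m) (hδ : 0 ≤ δ)
    (hI : ∀ t ∈ Set.Ioc a (a + δ), m ≤ |t| ∧ |t - x| ≤ 2 * δ) :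
    δ * ‖F x‖ ^ 2 ≤ 2 * C * m ^ (-s) * ‖e.snd‖ ^ 2 + 4 * δ ^ 2 * ‖e.fst‖ ^ 2 := by
  have hki : Integrable fun t => ‖e.snd t‖ ^ 2 :=
    (memLp_two_iff_integrable_sq_norm (Lp.aestronglyMeasurable _)).mp (Lp.memLp _)
  have hkn : ∫ t, ‖e.snd t‖ ^ 2 = ‖e.snd‖ ^ 2 := by
    have h1 := @inner_self_eq_norm_sq_to_K ℂ L2 _ _ _ e.snd
    rw [L2.inner_def] at h1
    simp_rw [inner_self_eq_norm_sq_to_K] at h1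
    apply Complex.ofReal_injective
    rw [← integral_complex_ofReal]
    push_cast
    exact h1
  -- From `‖F x‖² ≤ 2 ‖F t‖² + 2 ‖F t - F x‖²`: the potential, at least `m ^ s / C` at `t`, controls
  -- the first term, and the derivative over a distance at most `2 * δ` controls the second.
  -- Integrating over `t` gives the claim.
  have hpt : ∀ᵐ t ∂(volume.restrict (Set.Ioc a (a + δ))),
      ‖F x‖ ^ 2 ≤ 2 * C * m ^ (-s) * ‖e.snd t‖ ^ 2 + 4 * δ * ‖e.fst‖ ^ 2 := by
    rw [ae_restrict_iff' measurableSet_Ioc]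
    filter_upwards [hV, hk] with t hVt hkt ht
    obtain ⟨h1, h2⟩ := hI t ht
    have h3 : ‖F t - F x‖ ^ 2 ≤ 2 * δ * ‖e.fst‖ ^ 2 := by
      rw [hF x t]
      exact (sq_norm_integral_le _ _ _).trans (by gcongr)
    have h4 : ‖F x‖ ≤ ‖F t‖ + ‖F t - F x‖ := by
      have := norm_sub_le (F t) (F t - F x)
      simpa using this
    have hms : m ^ s ≤ C * V t := by
      have : m ^ s ≤ |t| ^ s := Real.rpow_le_rpow hm.le h1 hs.le
      have h5 : C * (C⁻¹ * |t| ^ s) ≤ C * V t := by gcongr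
      rw [mul_inv_cancel_left₀ hC.ne'] at h5
      linarith
    have hmp : 0 < m ^ s := Real.rpow_pos_of_pos hm s
    have hVp : 0 ≤ V t := by
      by_contra hneg
      nlinarith [not_le.mp hneg]
    have h5 : ‖F t‖ ^ 2 ≤ C * m ^ (-s) * ‖e.snd t‖ ^ 2 := by
      rw [hkt, norm_mul, mul_pow, Complex.norm_real, Real.norm_eq_abs, sq_abs, Real.sq_sqrt hVp,
        Real.rpow_neg hm.le]
      have : ‖F t‖ ^ 2 = (m ^ s)⁻¹ * (m ^ s * ‖F t‖ ^ 2) := by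
        rw [inv_mul_cancel_left₀ hmp.ne']
      have h6 : m ^ s * ‖F t‖ ^ 2 ≤ C * V t * ‖F t‖ ^ 2 := by gcongr
      calc ‖F t‖ ^ 2 = (m ^ s)⁻¹ * (m ^ s * ‖F t‖ ^ 2) := this
        _ ≤ (m ^ s)⁻¹ * (C * V t * ‖F t‖ ^ 2) := by gcongr
        _ = _ := by ring
    nlinarith [norm_nonneg (F x), norm_nonneg (F t), norm_nonneg (F t - F x),
      sq_nonneg (‖F t‖ - ‖F t - F x‖)]
  have hfin : IntegrableOn (fun _ : ℝ => ‖F x‖ ^ 2) (Set.Ioc a (a + δ)) :=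
    integrableOn_const (by simp)
  have hfin' : IntegrableOn (fun _ : ℝ => 4 * δ * ‖e.fst‖ ^ 2) (Set.Ioc a (a + δ)) :=
    integrableOn_const (by simp)
  have h := integral_mono_ae hfin (((hki.const_mul (2 * C * m ^ (-s))).integrableOn).add hfin') hpt
  rw [integral_add' ((hki.const_mul (2 * C * m ^ (-s))).integrableOn) hfin', integral_const_mul]
    at h
  simp only [setIntegral_const, Real.volume_real_Ioc, add_sub_cancel_left, max_eq_left hδ,
    smul_eq_mul] at h
  have h7 : ∫ t in Set.Ioc a (a + δ), ‖e.snd t‖ ^ 2 ≤ ‖e.snd‖ ^ 2 := by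
    rw [← hkn]
    exact setIntegral_le_integral hki (Filter.Eventually.of_forall fun t => by positivity)
  have h8 : 0 ≤ 2 * C * m ^ (-s) := by have := Real.rpow_nonneg hm.le (-s); positivity
  nlinarith [mul_le_mul_of_nonneg_left h7 h8]

/-- A function of finite energy decays like `|x| ^ (-s / 4)`. -/
theorem norm_sq_le_envelope {V : ℝ → ℝ} {s C : ℝ} (hs : 0 < s) (hC : 0 < C)
    (hV : ∀ᵐ x : ℝ, C⁻¹ * |x| ^ s ≤ V x) {F : ℝ → ℂ} {e : EnergySpace}
    (hF : ∀ x y, F y - F x = ∫ t in x..y, e.fst t)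
    (hk : (e.snd : ℝ → ℂ) =ᵐ[volume] fun x => (√(V x) : ℂ) * F x) (x : ℝ) :
    ‖F x‖ ^ 2 ≤ envelope s C x * ‖e‖ ^ 2 := by
  set m := max 1 |x| with hm
  have hm1 : 1 ≤ m := le_max_left _ _
  have hm0 : 0 < m := by linarith
  -- This length balances, after division by `δ`, the potential term `m ^ (-s) / δ` and the kinetic
  -- term `δ`.
  set δ := m ^ (-(s / 2)) with hδ
  have hδ0 : 0 < δ := Real.rpow_pos_of_pos hm0 _
  have hδ2 : m ^ (-s) = δ * δ := by
    rw [hδ, ← Real.rpow_add hm0]; ring_nf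
  -- The averaging interval starts at distance `m` from the origin rather than `|x|`; this bound
  -- keeps it within `2 * δ` of `x`. For `|x| ≤ 1` it holds because `δ = 1`.
  have hmx : m - |x| ≤ δ := by
    rcases le_total 1 |x| with h | h
    · rw [hm, max_eq_right h]; linarith
    · have : m = 1 := max_eq_left h
      rw [hδ, this, Real.one_rpow]; linarith [abs_nonneg x]
  have key : δ * ‖F x‖ ^ 2 ≤ 2 * C * m ^ (-s) * ‖e.snd‖ ^ 2 + 4 * δ ^ 2 * ‖e.fst‖ ^ 2 := by
    have hxm : |x| ≤ m := le_max_right _ _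
    rcases le_total 0 x with h | h
    · rw [abs_of_nonneg h] at hmx hxm
      refine norm_sq_mul_le_of_interval hs hC hV hF hk (a := m) hm0 hδ0.le fun t ht => ?_
      rw [abs_of_nonneg (by linarith [ht.1]), abs_of_nonneg (by linarith [ht.1])]
      exact ⟨ht.1.le, by linarith [ht.2]⟩
    · rw [abs_of_nonpos h] at hmx hxm
      refine norm_sq_mul_le_of_interval hs hC hV hF hk (a := -m - δ) hm0 hδ0.le fun t ht => ?_
      rw [abs_of_nonpos (by linarith [ht.2]), abs_of_nonpos (by linarith [ht.2])]
      exact ⟨by linarith [ht.2], by linarith [ht.1]⟩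
  have hen : ‖e‖ ^ 2 = ‖e.fst‖ ^ 2 + ‖e.snd‖ ^ 2 := WithLp.prod_norm_sq_eq_of_L2 e
  have h1 : ‖F x‖ ^ 2 ≤ δ * (2 * C * ‖e.snd‖ ^ 2 + 4 * ‖e.fst‖ ^ 2) := by
    rw [hδ2] at key
    have : δ * ‖F x‖ ^ 2 ≤ δ * (δ * (2 * C * ‖e.snd‖ ^ 2 + 4 * ‖e.fst‖ ^ 2)) := by
      calc _ ≤ _ := key
        _ = _ := by ring
    exact le_of_mul_le_mul_left this hδ0
  have h2 : δ ≤ 2 ^ (s / 2) * (1 + |x|) ^ (-(s / 2)) := by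
    have h3 : (1 + |x|) / 2 ≤ m := by
      linarith [le_max_left 1 |x|, le_max_right 1 |x|]
    have h4 : m ^ (-(s / 2)) ≤ ((1 + |x|) / 2) ^ (-(s / 2)) :=
      Real.rpow_le_rpow_of_nonpos (by positivity) h3 (by linarith)
    refine h4.trans (le_of_eq ?_)
    rw [Real.div_rpow (by positivity) (by norm_num), Real.rpow_neg (by norm_num : (0 : ℝ) ≤ 2),
      div_inv_eq_mul, mul_comm]
  have h3 : 2 * C * ‖e.snd‖ ^ 2 + 4 * ‖e.fst‖ ^ 2 ≤ (2 * C + 4) * ‖e‖ ^ 2 := by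
    rw [hen]
    nlinarith [mul_nonneg hC.le (sq_nonneg ‖e.fst‖), sq_nonneg ‖e.snd‖]
  calc ‖F x‖ ^ 2 ≤ δ * (2 * C * ‖e.snd‖ ^ 2 + 4 * ‖e.fst‖ ^ 2) := h1
    _ ≤ δ * ((2 * C + 4) * ‖e‖ ^ 2) := by gcongr
    _ ≤ (2 ^ (s / 2) * (1 + |x|) ^ (-(s / 2))) * ((2 * C + 4) * ‖e‖ ^ 2) := by gcongr
    _ = _ := by unfold envelope; ring

/-! ### Bounds on the diagonal of the Green function. -/

/-- The partial sums of the diagonal of the Green function are dominated by the envelope. -/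
theorem IsEigenSystem.ae_sum_le_envelope {V : ℝ → ℝ} {lam : ℕ → ℝ} {u : HilbertBasis ℕ ℂ L2}
    {e : ℕ → EnergySpace} (h : IsEigenSystem V lam u e) (hlam : ∀ n, 0 < lam n)
    {s C : ℝ} (hs : 0 < s) (hC : 0 < C) (hV : ∀ᵐ x : ℝ, C⁻¹ * |x| ^ s ≤ V x) :
    ∀ᵐ x, ∀ t : Finset ℕ, ∑ n ∈ t, ‖u n x‖ ^ 2 / lam n ≤ envelope s C x := by
  choose F hFu hF using fun n => (h.mem n).1.exists_primitive (locallyIntegrable_coe _)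
    (locallyIntegrable_coe _)
  -- The exceptional set only involves the countably many `u n` and their representatives, so it
  -- does not depend on `t`.
  filter_upwards [ae_all_iff.mpr hFu] with x hx t
  -- Coefficients of the truncated Green function with pole at `x`. Its value at `x` and its energy
  -- are the same number `G`, so the decay estimate reads `G ^ 2 ≤ envelope s C x * G`.
  set c : ℕ → ℂ := fun n => conj (u n x) / lam n with hc
  set E : EnergySpace := ∑ n ∈ t, c n • e n with hE
  have hfst : E.fst = ∑ n ∈ t, c n • (e n).fst :=
    map_sum (WithLp.fstL 2 ℂ L2 L2) (fun n => c n • e n) t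
  have hsnd : E.snd = ∑ n ∈ t, c n • (e n).snd :=
    map_sum (WithLp.sndL 2 ℂ L2 L2) (fun n => c n • e n) t
  have hcoe : ∀ v : ℕ → L2, ∀ᵐ y, (∑ n ∈ t, c n • v n : L2) y = ∑ n ∈ t, c n * v n y := by
    intro v
    have h1 : ∀ᵐ y, ∀ n, (c n • v n : L2) y = c n * v n y :=
      ae_all_iff.mpr fun n => (Lp.coeFn_smul _ _).mono fun y hy => hy
    filter_upwards [Lp.coeFn_fun_finsetSum t (fun n => c n • v n), h1] with y hy h1
    rw [hy]
    exact Finset.sum_congr rfl fun n _ => h1 n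
  have hint : ∀ n a b, IntervalIntegrable ((e n).fst : ℝ → ℂ) volume a b := fun n a b =>
    ((locallyIntegrable_coe _).integrableOn_isCompact isCompact_uIcc).intervalIntegrable
  have hb := norm_sq_le_envelope hs hC hV (F := fun y => ∑ n ∈ t, c n * F n y) (e := E)
    (fun y z => by
      rw [hfst, ← Finset.sum_sub_distrib,
        intervalIntegral.integral_congr_ae ((hcoe _).mono fun t ht _ => ht),
        intervalIntegral.integral_finsetSum fun n _ => (hint n _ _).const_mul _]
      refine Finset.sum_congr rfl fun n _ => ?_
      rw [← mul_sub, hF n, intervalIntegral.integral_const_mul])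
    (by
      rw [hsnd]
      filter_upwards [hcoe fun n => (e n).snd, ae_all_iff.mpr fun n => (h.mem n).2,
        ae_all_iff.mpr hFu] with y h1 h2 h3
      rw [h1, Finset.mul_sum]
      refine Finset.sum_congr rfl fun n _ => ?_
      rw [h2 n, h3 n]; ring) x
  set G := ∑ n ∈ t, ‖u n x‖ ^ 2 / lam n with hG
  have hG0 : 0 ≤ G := Finset.sum_nonneg fun n _ => div_nonneg (sq_nonneg _) (hlam n).le
  have h1 : ∑ n ∈ t, c n * F n x = (G : ℂ) := by
    rw [hG, Complex.ofReal_sum]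
    refine Finset.sum_congr rfl fun n _ => ?_
    rw [hx n, hc]
    push_cast
    rw [← Complex.conj_mul']; ring
  have h2 : ‖E‖ ^ 2 = G := by
    rw [hE, h.norm_sum_sq]
    refine Finset.sum_congr rfl fun n _ => ?_
    simp only [hc, norm_div, RCLike.norm_conj, Complex.norm_real, Real.norm_eq_abs,
      abs_of_pos (hlam n)]
    have := (hlam n).ne'
    field_simp
  simp only [h1, h2, Complex.norm_real, Real.norm_eq_abs, sq_abs] at hb
  rcases hG0.eq_or_lt with h0 | h0
  · rw [← h0]; exact (envelope_pos hC x).le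
  · rw [sq] at hb
    exact le_of_mul_le_mul_right hb h0

/-- The diagonal of the Green function is dominated by the envelope. -/
theorem IsEigenSystem.ae_greenDiag_le {V : ℝ → ℝ} {lam : ℕ → ℝ} {u : HilbertBasis ℕ ℂ L2}
    {e : ℕ → EnergySpace} (h : IsEigenSystem V lam u e) (hlam : ∀ n, 0 < lam n)
    {s C : ℝ} (hs : 0 < s) (hC : 0 < C) (hV : ∀ᵐ x : ℝ, C⁻¹ * |x| ^ s ≤ V x) :
    ∀ᵐ x, greenDiag lam u x ≤ ENNReal.ofReal (envelope s C x) := by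
  filter_upwards [h.ae_sum_le_envelope hlam hs hC hV] with x hx
  rw [greenDiag, ENNReal.tsum_eq_iSup_sum]
  refine iSup_le fun t => ?_
  rw [← ENNReal.ofReal_sum_of_nonneg fun n _ => div_nonneg (sq_nonneg _) (hlam n).le]
  exact ENNReal.ofReal_le_ofReal (hx t)

theorem measurable_greenDiag (lam : ℕ → ℝ) (u : HilbertBasis ℕ ℂ L2) :
    Measurable (greenDiag lam u) := by
  refine Measurable.tsum fun n => ?_
  have := (Lp.stronglyMeasurable (u n)).measurable
  fun_prop

theorem memLp_envelope {s C : ℝ} (hs : 0 < s) (hC : 0 < C) {p : ℝ≥0∞}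
    (hp : ENNReal.ofReal (2 / s) < p) : MemLp (envelope s C) p := by
  have hm := (continuous_envelope s C).aestronglyMeasurable (μ := (volume : Measure ℝ))
  by_cases hpt : p = ⊤
  · subst hpt
    refine memLp_top_of_bound hm ((2 * C + 4) * 2 ^ (s / 2)) (Filter.Eventually.of_forall ?_)
    intro x
    rw [Real.norm_of_nonneg (envelope_pos hC x).le]
    exact envelope_le hs hC x
  · have hp0 : p ≠ 0 := (bot_le.trans_lt hp).ne'
    rw [← integrable_norm_rpow_iff hm hp0 hpt]
    refine (integrable_envelope_rpow (s := s) (p := p.toReal) hC ?_).congr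
      (Filter.Eventually.of_forall fun x => ?_)
    · have h1 := (ENNReal.ofReal_lt_iff_lt_toReal (by positivity) hpt).mp hp
      rw [div_lt_iff₀ hs] at h1
      linarith
    · simp only [Real.norm_of_nonneg (envelope_pos (s := s) hC x).le]

theorem IsEigenSystem.memLp_greenDiag {V : ℝ → ℝ} {lam : ℕ → ℝ} {u : HilbertBasis ℕ ℂ L2}
    {e : ℕ → EnergySpace} (h : IsEigenSystem V lam u e) (hlam : ∀ n, 0 < lam n)
    {s C : ℝ} (hs : 0 < s) (hC : 0 < C) (hV : ∀ᵐ x : ℝ, C⁻¹ * |x| ^ s ≤ V x) {p : ℝ≥0∞}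
    (hp : ENNReal.ofReal (2 / s) < p) : MemLp (greenDiag lam u) p := by
  refine ⟨(measurable_greenDiag lam u).aestronglyMeasurable, ?_⟩
  refine lt_of_le_of_lt ?_ (memLp_envelope (C := C) hs hC hp).2
  refine eLpNorm_mono_enorm_ae ?_
  filter_upwards [h.ae_greenDiag_le hlam hs hC hV] with x hx
  rw [enorm_eq_self, Real.enorm_eq_ofReal (envelope_pos hC x).le]
  exact hx

/-! ### Uniqueness of the function with given coefficients. -/

/-- Interpolation between `L¹` and `L²`. -/
theorem eLpNorm_le_interpolation {f : ℝ → ℂ} (hf : AEStronglyMeasurable f volume) {q : ℝ}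
    (h1 : 1 ≤ q) (h2 : q ≤ 2) :
    eLpNorm f (ENNReal.ofReal q) volume ≤
      eLpNorm f 1 volume ^ ((2 - q) / q) * eLpNorm f 2 volume ^ (2 * (q - 1) / q) := by
  have hq : 0 < q := by linarith
  -- Hölder's inequality for `|f|` and `|f|²` with weights `2 - q` and `q - 1`, which sum to `1`.
  have h := ENNReal.lintegral_mul_norm_pow_le (μ := volume) (f := fun x => ‖f x‖ₑ)
    (g := fun x => ‖f x‖ₑ ^ (2 : ℝ)) hf.enorm (hf.enorm.pow_const _) (p := 2 - q) (q := q - 1)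
    (by linarith) (by linarith) (by ring)
  have h3 : ∀ x, ‖f x‖ₑ ^ (2 - q) * (‖f x‖ₑ ^ (2 : ℝ)) ^ (q - 1) = ‖f x‖ₑ ^ q := fun x => by
    rw [← ENNReal.rpow_mul, ← ENNReal.rpow_add_of_nonneg _ _ (by linarith) (by linarith)]
    ring_nf
  simp_rw [h3] at h
  rw [eLpNorm_eq_lintegral_rpow_enorm_toReal (by simpa using hq) ENNReal.ofReal_ne_top,
    ENNReal.toReal_ofReal hq.le, eLpNorm_one_eq_lintegral_enorm,
    eLpNorm_eq_lintegral_rpow_enorm_toReal (p := 2) (by norm_num) (by norm_num),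
    ENNReal.toReal_ofNat]
  refine (ENNReal.rpow_le_rpow h (by positivity)).trans (le_of_eq ?_)
  rw [ENNReal.mul_rpow_of_nonneg _ _ (by positivity), ← ENNReal.rpow_mul, ← ENNReal.rpow_mul,
    ← ENNReal.rpow_mul]
  congr 2
  · ring
  · ring

theorem enorm_snd_le (e : EnergySpace) : ‖e.snd‖ₑ ≤ ‖e‖ₑ := by
  rw [← ofReal_norm, ← ofReal_norm]
  refine ENNReal.ofReal_le_ofReal ?_
  have : ‖e‖ ^ 2 = ‖e.fst‖ ^ 2 + ‖e.snd‖ ^ 2 := WithLp.prod_norm_sq_eq_of_L2 e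
  exact le_of_sq_le_sq (by nlinarith [sq_nonneg ‖e.fst‖]) (norm_nonneg _)

/-- The form domain is continuously embedded in `L¹`. -/
theorem exists_eLpNorm_one_le {V : ℝ → ℝ} {s C : ℝ} (hs : 1 < s) (hC : 0 < C)
    (hV : ∀ᵐ x : ℝ, C⁻¹ * |x| ^ s ≤ V x) :
    ∃ D : ℝ≥0∞, D ≠ ⊤ ∧ ∀ p ∈ energyGraph V,
      eLpNorm p.1 1 volume ≤ D * (‖p.1‖ₑ + ‖p.2‖ₑ) := by
  have hs0 : 0 < s := by linarith
  -- The square of the envelope decays like `|x| ^ (-s)`, so `s > 1` is exactly what is needed.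
  have hK : MemLp (envelope s C) 2 := memLp_envelope hs0 hC (by
    rw [ENNReal.ofReal_lt_iff_lt_toReal (by positivity) (by norm_num), div_lt_iff₀ hs0]
    norm_num; linarith)
  refine ⟨eLpNorm (envelope s C) 2 volume, hK.2.ne, ?_⟩
  rintro ⟨w, e⟩ ⟨-, hk⟩
  simp only at hk ⊢
  -- The envelope now serves as a weight: its inverse is of order `(1 + |x|) ^ (s / 2)`, hence at
  -- most a constant times `1 + √V`. Cauchy–Schwarz then bounds the `L¹` norm.
  have hpt : ∀ᵐ x, ‖w x‖ ≤ ‖(envelope s C • fun x => ‖w x‖ + ‖e.snd x‖) x‖ := by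
    filter_upwards [hV, hk] with x hVx hkx
    have hk' : |x| ^ (s / 2) * ‖w x‖ ≤ √C * ‖e.snd x‖ := by
      rw [hkx, norm_mul, Complex.norm_real, Real.norm_of_nonneg (Real.sqrt_nonneg _), ← mul_assoc,
        ← Real.sqrt_mul hC.le]
      gcongr
      refine Real.le_sqrt_of_sq_le ?_
      rw [← Real.rpow_natCast, ← Real.rpow_mul (abs_nonneg x)]
      have h5 : C * (C⁻¹ * |x| ^ s) ≤ C * V x := by gcongr
      rw [mul_inv_cancel_left₀ hC.ne'] at h5
      simpa using h5
    have hsC : √C ≤ 2 * C + 4 := by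
      nlinarith [Real.sq_sqrt hC.le, sq_nonneg (√C - 1), Real.sqrt_nonneg C]
    have h1 : (1 + |x|) ^ (s / 2) ≤ 2 ^ (s / 2) * (1 + |x| ^ (s / 2)) := by
      have hle : 1 + |x| ≤ 2 * max 1 |x| := by
        linarith [le_max_left 1 |x|, le_max_right 1 |x|]
      calc (1 + |x|) ^ (s / 2) ≤ (2 * max 1 |x|) ^ (s / 2) := by gcongr
        _ = 2 ^ (s / 2) * (max 1 |x|) ^ (s / 2) := Real.mul_rpow (by norm_num) (by positivity)
        _ ≤ _ := by
          gcongr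
          rcases le_total 1 |x| with h | h
          · rw [max_eq_right h]; linarith
          · rw [max_eq_left h, Real.one_rpow]
            have := Real.rpow_nonneg (abs_nonneg x) (s / 2)
            linarith
    have hp : 0 < 1 + |x| := by positivity
    have hpp : 0 < (1 + |x|) ^ (s / 2) := Real.rpow_pos_of_pos hp _
    rw [Pi.smul_apply', smul_eq_mul, Real.norm_of_nonneg (mul_nonneg (envelope_pos hC x).le
      (by positivity)), envelope, Real.rpow_neg hp.le]
    have h2 : (1 + |x|) ^ (s / 2) * ‖w x‖
        ≤ (2 * C + 4) * 2 ^ (s / 2) * (‖w x‖ + ‖e.snd x‖) := by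
      calc (1 + |x|) ^ (s / 2) * ‖w x‖ ≤ 2 ^ (s / 2) * (1 + |x| ^ (s / 2)) * ‖w x‖ := by gcongr
        _ = 2 ^ (s / 2) * (‖w x‖ + |x| ^ (s / 2) * ‖w x‖) := by ring
        _ ≤ 2 ^ (s / 2) * (‖w x‖ + √C * ‖e.snd x‖) := by gcongr
        _ ≤ 2 ^ (s / 2) * ((2 * C + 4) * ‖w x‖ + (2 * C + 4) * ‖e.snd x‖) := by
          gcongr
          nlinarith [norm_nonneg (w x)]
        _ = _ := by ring
    calc ‖w x‖ = ((1 + |x|) ^ (s / 2))⁻¹ * ((1 + |x|) ^ (s / 2) * ‖w x‖) := by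
          rw [inv_mul_cancel_left₀ hpp.ne']
      _ ≤ ((1 + |x|) ^ (s / 2))⁻¹ * ((2 * C + 4) * 2 ^ (s / 2) * (‖w x‖ + ‖e.snd x‖)) := by
          gcongr
      _ = _ := by ring
  have hw := (Lp.aestronglyMeasurable w).norm
  have he := (Lp.aestronglyMeasurable e.snd).norm
  calc eLpNorm w 1 volume ≤ eLpNorm (envelope s C • fun x => ‖w x‖ + ‖e.snd x‖) 1 volume :=
        eLpNorm_mono_ae hpt
    _ ≤ eLpNorm (envelope s C) 2 volume * eLpNorm (fun x => ‖w x‖ + ‖e.snd x‖) 2 volume :=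
        eLpNorm_smul_le_mul_eLpNorm (hw.add he) hK.1
    _ ≤ eLpNorm (envelope s C) 2 volume * (‖w‖ₑ + ‖e‖ₑ) := by
        gcongr
        refine (eLpNorm_add_le hw he (by norm_num)).trans ?_
        rw [eLpNorm_norm, eLpNorm_norm, ← Lp.enorm_def, ← Lp.enorm_def]
        gcongr
        exact enorm_snd_le e

/-- Interpolates between the `L¹` embedding and membership in `L²`. With `q` conjugate to `r > 2`,
it makes the pairing of the form domain with `L^r` well defined. -/
theorem memLp_of_mem_energyGraph {V : ℝ → ℝ} {s C : ℝ} (hs : 1 < s) (hC : 0 < C)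
    (hV : ∀ᵐ x : ℝ, C⁻¹ * |x| ^ s ≤ V x) {q : ℝ} (h1 : 1 ≤ q) (h2 : q ≤ 2)
    {p : L2 × EnergySpace} (hp : p ∈ energyGraph V) : MemLp p.1 (ENNReal.ofReal q) := by
  obtain ⟨D, hD, h⟩ := exists_eLpNorm_one_le hs hC hV
  have hm := Lp.aestronglyMeasurable p.1
  refine ⟨hm, (eLpNorm_le_interpolation hm h1 h2).trans_lt ?_⟩
  have h3 : eLpNorm p.1 1 volume ≠ ⊤ := ((h p hp).trans_lt (by finiteness)).ne
  have h4 : eLpNorm p.1 2 volume ≠ ⊤ := Lp.eLpNorm_ne_top p.1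
  exact ENNReal.mul_lt_top (ENNReal.rpow_lt_top_of_nonneg (div_nonneg (by linarith) (by linarith)) h3)
    (ENNReal.rpow_lt_top_of_nonneg (div_nonneg (by linarith) (by linarith)) h4)

theorem integrable_conj_mul {q r : ℝ≥0∞} [ENNReal.HolderConjugate q r] {f g : ℝ → ℂ}
    (hf : MemLp f q) (hg : MemLp g r) : Integrable fun x => conj (f x) * g x := by
  have : MemLp (fun x => conj (f x)) q := hf.star
  exact this.integrable_mul hg

theorem enorm_integral_conj_mul_le {q r : ℝ≥0∞} [ENNReal.HolderConjugate q r] {f g : ℝ → ℂ}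
    (hf : AEStronglyMeasurable f) (hg : AEStronglyMeasurable g) :
    ‖∫ x, conj (f x) * g x‖ₑ ≤ eLpNorm f q volume * eLpNorm g r volume := by
  refine (enorm_integral_le_lintegral_enorm _).trans ?_
  have h := eLpNorm_smul_le_mul_eLpNorm (p := q) (q := r) (r := 1) hg hf
  rw [eLpNorm_one_eq_lintegral_enorm] at h
  refine le_trans (le_of_eq ?_) h
  refine lintegral_congr fun x => ?_
  rw [Pi.smul_apply', smul_eq_mul, enorm_mul, enorm_mul, ← ofReal_norm, RCLike.norm_conj,
    ofReal_norm]

/-- A function in `L^r` orthogonal to all eigenfunctions is orthogonal to the form domain. -/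
theorem IsEigenSystem.integral_conj_mul_eq_zero {V : ℝ → ℝ} {lam : ℕ → ℝ}
    {u : HilbertBasis ℕ ℂ L2} {e : ℕ → EnergySpace} (h : IsEigenSystem V lam u e)
    {s C : ℝ} (hs : 1 < s) (hC : 0 < C)
    (hV : ∀ᵐ x : ℝ, C⁻¹ * |x| ^ s ≤ V x) {q r : ℝ} (hqr : q.HolderConjugate r) (hr : 2 < r)
    {d : ℝ → ℂ} (hd : MemLp d (ENNReal.ofReal r)) (hd0 : ∀ n, ∫ x, conj (u n x) * d x = 0)
    {p : L2 × EnergySpace} (hp : p ∈ energyGraph V) : ∫ x, conj (p.1 x) * d x = 0 := by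
  have : ENNReal.HolderConjugate (ENNReal.ofReal q) (ENNReal.ofReal r) := hqr.ennrealOfReal
  have hq1 : 1 < q := hqr.lt
  have hq2 : q ≤ 2 := by
    have h1 := hqr.inv_add_inv_eq_one
    have h2 : r⁻¹ < 2⁻¹ := inv_strictAnti₀ (by norm_num) hr
    have h3 : (2 : ℝ)⁻¹ ≤ q⁻¹ := by linarith
    exact (inv_le_inv₀ (by norm_num) (by linarith)).mp h3
  obtain ⟨D, hD, hL1⟩ := exists_eLpNorm_one_le hs hC hV
  let c : ℕ → ℂ := fun n => ⟪u n, p.1⟫_ℂ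
  let w : ℕ → L2 := fun N => ∑ n ∈ Finset.range N, c n • u n
  let η : ℕ → EnergySpace := fun N => ∑ n ∈ Finset.range N, c n • e n
  have hmem : ∀ N, (p.1 - w N, p.2 - η N) ∈ energyGraph V := fun N =>
    Submodule.sub_mem _ hp (h.sum_mem _ c)
  have hlim : Filter.Tendsto (fun N => ‖p.1 - w N‖ₑ) Filter.atTop (nhds 0) := by
    have h1 : Filter.Tendsto w Filter.atTop (nhds p.1) := by
      have := (u.hasSum_repr p.1).tendsto_sum_nat
      simpa only [u.repr_apply_apply] using this
    have h2 := (tendsto_const_nhds (x := p.1)).sub h1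
    rw [sub_self] at h2
    simpa using h2.enorm
  -- Since `d` annihilates the partial sum `w N`, only the remainder contributes. It stays bounded
  -- in `L¹`, by Bessel's inequality for the energy, and tends to zero in `L²`, hence also in `L^q`
  -- because `q > 1`.
  have hbound : ∀ N, ‖∫ x, conj (p.1 x) * d x‖ₑ ≤
      (D * (‖p.1 - w N‖ₑ + ‖p.2‖ₑ)) ^ ((2 - q) / q) * ‖p.1 - w N‖ₑ ^ (2 * (q - 1) / q) *
        eLpNorm d (ENNReal.ofReal r) volume := fun N => by
    have h1 : ∫ x, conj (p.1 x) * d x = ∫ x, conj ((p.1 - w N : L2) x) * d x := by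
      have hi : ∀ n, Integrable fun x => conj (u n x) * d x := fun n =>
        integrable_conj_mul (memLp_of_mem_energyGraph hs hC hV hq1.le hq2 (h.mem n)) hd
      have hc : ∀ᵐ x, ∀ n, (c n • u n : L2) x = c n * u n x :=
        ae_all_iff.mpr fun n => Lp.coeFn_smul _ _
      have h2 : ∫ x, conj ((p.1 - w N : L2) x) * d x =
          ∫ x, (conj (p.1 x) * d x -
            ∑ n ∈ Finset.range N, conj (c n) * (conj (u n x) * d x)) := by
        apply integral_congr_ae
        filter_upwards [Lp.coeFn_sub p.1 (w N), hc,
          Lp.coeFn_fun_finsetSum (Finset.range N) (fun n => c n • u n)] with x h3 h4 h5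
        rw [h3, Pi.sub_apply, h5, map_sub, map_sum, sub_mul, Finset.sum_mul]
        congr 1
        refine Finset.sum_congr rfl fun n _ => ?_
        rw [h4 n, map_mul, mul_assoc]
      rw [h2, integral_sub
        (integrable_conj_mul (memLp_of_mem_energyGraph hs hC hV hq1.le hq2 hp) hd)
        (integrable_finsetSum _ fun n _ => (hi n).const_mul _),
        integral_finsetSum _ fun n _ => (hi n).const_mul _]
      simp [integral_const_mul, hd0]
    rw [h1]
    refine (enorm_integral_conj_mul_le (q := ENNReal.ofReal q) (r := ENNReal.ofReal r)
      (Lp.aestronglyMeasurable _) hd.1).trans ?_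
    gcongr
    refine (eLpNorm_le_interpolation (Lp.aestronglyMeasurable _) hq1.le hq2).trans ?_
    rw [← Lp.enorm_def]
    refine mul_le_mul' (ENNReal.rpow_le_rpow ?_ (div_nonneg (by linarith) (by linarith))) le_rfl
    refine (hL1 _ (hmem N)).trans ?_
    gcongr
    rw [enorm_le_iff_norm_le]
    exact h.norm_sub_sum_le _ hp
  have hz : (0 : ℝ≥0∞) ^ (2 * (q - 1) / q) = 0 :=
    ENNReal.zero_rpow_of_pos (div_pos (by linarith) (by linarith))
  have ht : Filter.Tendsto (fun N => (D * (‖p.1 - w N‖ₑ + ‖p.2‖ₑ)) ^ ((2 - q) / q) *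
      ‖p.1 - w N‖ₑ ^ (2 * (q - 1) / q) * eLpNorm d (ENNReal.ofReal r) volume) Filter.atTop
      (nhds ((D * (0 + ‖p.2‖ₑ)) ^ ((2 - q) / q) * 0 ^ (2 * (q - 1) / q) *
        eLpNorm d (ENNReal.ofReal r) volume)) := by
    refine ENNReal.Tendsto.mul_const (ENNReal.Tendsto.mul ?_ (Or.inr ?_) ?_ (Or.inr ?_))
      (Or.inr hd.2.ne)
    · exact ((ENNReal.Tendsto.const_mul (hlim.add_const _) (Or.inr hD))).ennrpow_const _
    · rw [hz]; exact ENNReal.zero_ne_top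
    · exact hlim.ennrpow_const _
    · exact (ENNReal.rpow_lt_top_of_nonneg (div_nonneg (by linarith) (by linarith))
        (by finiteness)).ne
  rw [hz, mul_zero, zero_mul] at ht
  have := ge_of_tendsto' ht hbound
  simpa using this

/-- The form domain is stable under multiplication by test functions. -/
theorem exists_mem_energyGraph_mul {V : ℝ → ℝ} {f : L2} {e : EnergySpace}
    (h : (f, e) ∈ energyGraph V) {χ : ℝ → ℂ} (hχ : ContDiff ℝ ∞ χ) (hχc : HasCompactSupport χ) :
    ∃ p ∈ energyGraph V, (p.1 : ℝ → ℂ) =ᵐ[volume] fun x => χ x * f x := by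
  have hmul : ∀ {χ : ℝ → ℂ}, Continuous χ → HasCompactSupport χ → ∀ f : L2,
      MemLp (fun x => χ x * f x) 2 := fun hχ hχc f =>
    (Lp.memLp f).mul' (hχ.memLp_top_of_hasCompactSupport hχc volume)
  have hχ' : ContDiff ℝ ∞ (deriv χ) := (contDiff_infty_iff_deriv.mp hχ).2
  have m1 := hmul hχ.continuous hχc f
  have m2 := (hmul hχ'.continuous hχc.deriv f).add (hmul hχ.continuous hχc e.fst)
  have m3 := hmul hχ.continuous hχc e.snd
  refine ⟨(m1.toLp _, WithLp.toLp 2 (m2.toLp _, m3.toLp _)), ⟨?_, ?_⟩, m1.coeFn_toLp⟩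
  · have : HasWeakDeriv (fun x => χ x * f x)
        ((fun x => deriv χ x * f x) + fun x => χ x * e.fst x) := fun φ hφ hφc => by
      have h1 := h.1 (fun x => χ x * φ x) (hχ.mul hφ) hχc.mul_right
      have hd : ∀ x, deriv (fun x => χ x * φ x) x = deriv χ x * φ x + χ x * deriv φ x := fun x =>
        ((hχ.differentiable (by simp) x).hasDerivAt.mul
          (hφ.differentiable (by simp) x).hasDerivAt).deriv
      have hφ' : ContDiff ℝ ∞ (deriv φ) := (contDiff_infty_iff_deriv.mp hφ).2
      have i1 := integrable_testFunction_mul (hχ'.mul hφ) (hφc.mul_left) (locallyIntegrable_coe f)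
      have i2 := integrable_testFunction_mul (hχ.mul hφ') (hφc.deriv.mul_left)
        (locallyIntegrable_coe f)
      have i3 := integrable_testFunction_mul (hχ.mul hφ) (hφc.mul_left)
        (locallyIntegrable_coe e.fst)
      simp_rw [hd, add_mul] at h1
      rw [integral_add i1 i2] at h1
      have e1 : ∫ x, deriv φ x * (χ x * f x) = ∫ x, χ x * deriv φ x * f x := by
        congr 1; ext x; ring
      have e2 : ∫ x, φ x * ((fun x => deriv χ x * f x) + fun x => χ x * e.fst x) x =
          ∫ x, (deriv χ x * φ x * f x + χ x * φ x * e.fst x) := by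
        congr 1; ext x; simp only [Pi.add_apply]; ring
      rw [e1, e2, integral_add i1 i3]
      linear_combination h1
    exact this.congr m1.coeFn_toLp m2.coeFn_toLp
  · filter_upwards [m1.coeFn_toLp, m3.coeFn_toLp, h.2] with x h1 h2 h3
    change m3.toLp _ x = _ * m1.toLp _ x
    rw [h1, h2, h3]; ring

/-- The functions of a Hilbert basis of `L²(ℝ)` have no common zeros, up to a null set. -/
theorem ae_exists_ne_zero (u : HilbertBasis ℕ ℂ L2) : ∀ᵐ x : ℝ, ∃ n, u n x ≠ 0 := by
  set Z : Set ℝ := {x | ∀ n, u n x = 0} with hZ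
  have hZm : MeasurableSet Z := by
    rw [hZ, Set.ofPred_forall]
    exact MeasurableSet.iInter fun n =>
      (Lp.stronglyMeasurable (u n)).measurable (measurableSet_singleton 0)
  have hfin : ∀ N : ℕ, volume (Z ∩ Set.Icc (-N : ℝ) N) = 0 := fun N => by
    have hm : MeasurableSet (Z ∩ Set.Icc (-N : ℝ) N) := hZm.inter measurableSet_Icc
    have hf : volume (Z ∩ Set.Icc (-N : ℝ) N) ≠ ⊤ :=
      ((measure_mono Set.inter_subset_right).trans_lt (by simp)).ne
    -- The indicator of a bounded piece of the common zero set lies in `L²` and is orthogonal to the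
    -- whole basis.
    have h0 : indicatorConstLp 2 hm hf (1 : ℂ) = 0 := by
      apply u.repr.injective
      ext n
      rw [u.repr_apply_apply, map_zero, lp.coeFn_zero, Pi.zero_apply, ← inner_conj_symm,
        L2.inner_indicatorConstLp_one, setIntegral_eq_zero_of_forall_eq_zero (fun x hx => hx.1 n),
        map_zero]
    have h1 : ‖indicatorConstLp 2 hm hf (1 : ℂ)‖ = 0 := by rw [h0, norm_zero]
    rw [norm_indicatorConstLp (by norm_num) (by norm_num), norm_one, one_mul,
      Real.rpow_eq_zero measureReal_nonneg (by norm_num), measureReal_eq_zero_iff hf] at h1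
    exact h1
  have hZ0 : volume Z = 0 := by
    have : Z = ⋃ N : ℕ, Z ∩ Set.Icc (-N : ℝ) N := by
      ext x
      simp only [Set.mem_iUnion, Set.mem_inter_iff, exists_and_left, iff_self_and, Set.mem_Icc]
      intro _
      obtain ⟨N, hN⟩ := exists_nat_ge |x|
      exact ⟨N, abs_le.mp hN⟩
    rw [this]
    exact measure_iUnion_null hfin
  refine (measure_eq_zero_iff_ae_notMem.mp hZ0).mono fun x hx => ?_
  simpa [hZ] using hx

/-- A function in `L^r`, `r > 2`, is determined by its coefficients. -/
theorem IsEigenSystem.ae_eq_zero {V : ℝ → ℝ} {lam : ℕ → ℝ}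
    {u : HilbertBasis ℕ ℂ L2} {e : ℕ → EnergySpace} (h : IsEigenSystem V lam u e)
    {s C : ℝ} (hs : 1 < s) (hC : 0 < C)
    (hV : ∀ᵐ x : ℝ, C⁻¹ * |x| ^ s ≤ V x) {q r : ℝ} (hqr : q.HolderConjugate r) (hr : 2 < r)
    {d : ℝ → ℂ} (hd : MemLp d (ENNReal.ofReal r)) (hi : ∀ n, Integrable fun x => conj (u n x) * d x)
    (hd0 : ∀ n, ∫ x, conj (u n x) * d x = 0) : d =ᵐ[volume] 0 := by
  have h1 : ∀ n, ∀ᵐ x, conj (u n x) * d x = 0 := fun n => by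
    refine ae_eq_zero_of_integral_contDiff_smul_eq_zero (hi n).locallyIntegrable
      fun χ hχ hχc => ?_
    -- A test function alone may leave the form domain, as `V` need not be locally integrable; its
    -- product with an eigenfunction does not.
    obtain ⟨p, hp, hpe⟩ := exists_mem_energyGraph_mul (h.mem n) (χ := fun x => (χ x : ℂ))
      (Complex.ofRealCLM.contDiff.comp hχ)
      (hχc.comp_left (g := fun x : ℝ => (x : ℂ)) (by simp))
    rw [← h.integral_conj_mul_eq_zero hs hC hV hqr hr hd hd0 hp]
    apply integral_congr_ae
    filter_upwards [hpe] with x hx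
    rw [hx, map_mul, Complex.conj_ofReal, Complex.real_smul, mul_assoc]
  filter_upwards [ae_all_iff.mpr h1, ae_exists_ne_zero u] with x hx ⟨n, hn⟩
  have := hx n
  simpa [hn] using this

/-! ### Complex Gaussian variables and their linear combinations. -/

theorem integrable_exp_neg_mul_sq_add_inner {l : ℝ} (hl : 0 < l) (b : ℂ) :
    Integrable fun z : ℂ => Real.exp (-l * ‖z‖ ^ 2 + 2 * ⟪b, z⟫_ℝ) := by
  have h := (GaussianFourier.integrable_cexp_neg_mul_sq_norm_add (V := ℂ) (b := (l : ℂ))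
    (by simpa using hl) 2 b).norm
  refine h.congr (Filter.Eventually.of_forall fun z => ?_)
  simp only [Complex.norm_exp]
  congr 1
  norm_cast

theorem integral_exp_neg_mul_sq_add_inner {l : ℝ} (hl : 0 < l) (b : ℂ) :
    ∫ z : ℂ, Real.exp (-l * ‖z‖ ^ 2 + 2 * ⟪b, z⟫_ℝ) =
      Real.pi / l * Real.exp (‖b‖ ^ 2 / l) := by
  have h := GaussianFourier.integral_cexp_neg_mul_sq_norm_add (V := ℂ) (b := (l : ℂ))
    (by simpa using hl) 2 b
  apply Complex.ofReal_injective
  rw [← integral_complex_ofReal]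
  have hl' : (l : ℂ) ≠ 0 := by exact_mod_cast hl.ne'
  push_cast
  rw [h, Complex.finrank_real_complex]
  have : (2 : ℂ) ^ 2 * ‖b‖ ^ 2 / (4 * l) = ‖b‖ ^ 2 / l := by field_simp; ring
  rw [this]
  norm_num

theorem measurable_density (l : ℝ) :
    Measurable fun z : ℂ => ENNReal.ofReal (l / Real.pi * Real.exp (-l * ‖z‖ ^ 2)) := by
  fun_prop

/-- The Laplace transform of a complex Gaussian variable. -/
theorem lintegral_exp_inner_complexGaussian {l : ℝ} (hl : 0 < l) (b : ℂ) :
    ∫⁻ z, ENNReal.ofReal (Real.exp (2 * ⟪b, z⟫_ℝ)) ∂complexGaussian l =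
      ENNReal.ofReal (Real.exp (‖b‖ ^ 2 / l)) := by
  have hpi := Real.pi_pos
  rw [complexGaussian, lintegral_withDensity_eq_lintegral_mul _ (measurable_density l)
    (by fun_prop)]
  have h : ∀ z : ℂ, ((fun z : ℂ => ENNReal.ofReal (l / Real.pi * Real.exp (-l * ‖z‖ ^ 2))) *
      fun z => ENNReal.ofReal (Real.exp (2 * ⟪b, z⟫_ℝ))) z =
      ENNReal.ofReal (l / Real.pi * Real.exp (-l * ‖z‖ ^ 2 + 2 * ⟪b, z⟫_ℝ)) := fun z => by
    rw [Pi.mul_apply, ← ENNReal.ofReal_mul (by positivity), Real.exp_add, mul_assoc]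
  simp_rw [h]
  rw [← ofReal_integral_eq_lintegral_ofReal
    ((integrable_exp_neg_mul_sq_add_inner hl b).const_mul _)
    (Filter.Eventually.of_forall fun z => by positivity), integral_const_mul,
    integral_exp_neg_mul_sq_add_inner hl]
  congr 1
  field_simp

/-- Halving the Gaussian exponent doubles the integral over the plane; this is the universal
constant in the concentration bound. -/
theorem lintegral_exp_half_sq_complexGaussian_one :
    ∫⁻ z, ENNReal.ofReal (Real.exp (‖z‖ ^ 2 / 2)) ∂complexGaussian 1 = 2 := by
  have hpi := Real.pi_pos
  rw [complexGaussian, lintegral_withDensity_eq_lintegral_mul _ (measurable_density 1)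
    (by fun_prop)]
  have h : ∀ z : ℂ, ((fun z : ℂ => ENNReal.ofReal (1 / Real.pi * Real.exp (-1 * ‖z‖ ^ 2))) *
      fun z : ℂ => ENNReal.ofReal (Real.exp (‖z‖ ^ 2 / 2))) z =
      ENNReal.ofReal (1 / Real.pi *
        Real.exp (-(1 / 2 : ℝ) * ‖z‖ ^ 2 + 2 * ⟪(0 : ℂ), z⟫_ℝ)) := fun z => by
    rw [Pi.mul_apply, ← ENNReal.ofReal_mul (by positivity), mul_assoc, ← Real.exp_add,
      inner_zero_left]
    ring_nf
  simp_rw [h]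
  rw [← ofReal_integral_eq_lintegral_ofReal
    ((integrable_exp_neg_mul_sq_add_inner (by norm_num) 0).const_mul _)
    (Filter.Eventually.of_forall fun z => by positivity), integral_const_mul,
    integral_exp_neg_mul_sq_add_inner (by norm_num)]
  have : 1 / Real.pi * (Real.pi / (1 / 2) * Real.exp (‖(0 : ℂ)‖ ^ 2 / (1 / 2))) = 2 := by
    simp
  rw [this]; norm_num

theorem inner_mul_right_eq (b c z : ℂ) : ⟪b, c * z⟫_ℝ = ⟪conj c * b, z⟫_ℝ := by
  simp only [Complex.inner, map_mul, Complex.conj_conj]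
  ring_nf

section

variable {lam : ℕ → ℝ} {μ : Measure (ℕ → ℂ)}

/-- The Laplace transform of a linear combination of independent complex Gaussian variables. -/
theorem IsFreeGibbsMeasure.lintegral_exp_inner_sum (hμ : IsFreeGibbsMeasure lam μ)
    (hlam : ∀ n, 0 < lam n) (t : Finset ℕ) (c : ℕ → ℂ) (b : ℂ) :
    ∫⁻ α, ENNReal.ofReal (Real.exp (2 * ⟪b, ∑ n ∈ t, c n * α n⟫_ℝ)) ∂μ =
      ENNReal.ofReal (Real.exp (‖b‖ ^ 2 * ∑ n ∈ t, ‖c n‖ ^ 2 / lam n)) := by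
  classical
  have hprob : ∀ n, IsProbabilityMeasure (complexGaussian (lam n)) := fun n =>
    isProbabilityMeasure_complexGaussian (hlam n)
  set K := t.sup id with hK
  have hsub : t ⊆ Finset.range (K + 1) := fun n hn =>
    Finset.mem_range.mpr (Nat.lt_succ_of_le (Finset.le_sup (f := id) hn))
  -- Padding by zeros replaces `t` by an initial segment, where the cylindrical projection gives the
  -- law.
  set d : ℕ → ℂ := fun n => if n ∈ t then c n else 0 with hd
  have h1 : ∀ α : ℕ → ℂ, ∑ n ∈ t, c n * α n = ∑ j : Fin (K + 1), d j * α j := fun α => by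
    rw [← Finset.sum_range (fun n => d n * α n), ← Finset.sum_subset hsub]
    · exact Finset.sum_congr rfl fun n hn => by simp [hd, hn]
    · intro n _ hn; simp [hd, hn]
  have h2 : ∑ n ∈ t, ‖c n‖ ^ 2 / lam n = ∑ j : Fin (K + 1), ‖d j‖ ^ 2 / lam j := by
    rw [← Finset.sum_range (fun n => ‖d n‖ ^ 2 / lam n), ← Finset.sum_subset hsub]
    · exact Finset.sum_congr rfl fun n hn => by simp [hd, hn]
    · intro n _ hn; simp [hd, hn]
  simp_rw [h1, h2]
  have hmeas : Measurable (fun (α : ℕ → ℂ) (j : Fin (K + 1)) => α j) := by fun_prop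
  have h3 : ∀ β : Fin (K + 1) → ℂ,
      ENNReal.ofReal (Real.exp (2 * ⟪b, ∑ j : Fin (K + 1), d j * β j⟫_ℝ)) =
        ∏ j : Fin (K + 1), ENNReal.ofReal (Real.exp (2 * ⟪conj (d j) * b, β j⟫_ℝ)) := fun β => by
    rw [← ENNReal.ofReal_prod_of_nonneg fun _ _ => (Real.exp_pos _).le, ← Real.exp_sum,
      _root_.inner_sum, Finset.mul_sum]
    simp_rw [inner_mul_right_eq]
  have h4 := lintegral_map (μ := μ)
    (f := fun β : Fin (K + 1) → ℂ => ENNReal.ofReal (Real.exp (2 * ⟪b, ∑ j : Fin (K + 1), d j * β j⟫_ℝ)))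
    (by fun_prop) hmeas
  rw [← h4, hμ.proj K]
  simp_rw [h3]
  have hind := ProbabilityTheory.iIndepFun_pi (μ := fun j : Fin (K + 1) => complexGaussian (lam j))
    (X := fun j z => ENNReal.ofReal (Real.exp (2 * ⟪conj (d j) * b, z⟫_ℝ)))
    (fun j => by fun_prop)
  have h5 := ProbabilityTheory.lintegral_prod_eq_prod_lintegral_of_indepFun Finset.univ _ hind
    (fun j => by fun_prop)
  have h6 : ∀ j : Fin (K + 1), ∫⁻ β, ENNReal.ofReal (Real.exp (2 * ⟪conj (d j) * b, β j⟫_ℝ))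
      ∂Measure.pi (fun j : Fin (K + 1) => complexGaussian (lam j)) =
      ENNReal.ofReal (Real.exp (‖b‖ ^ 2 * (‖d j‖ ^ 2 / lam j))) := fun j => by
    rw [(measurePreserving_eval (fun j : Fin (K + 1) => complexGaussian (lam j)) j).lintegral_comp
      (f := fun z => ENNReal.ofReal (Real.exp (2 * ⟪conj (d j) * b, z⟫_ℝ))) (by fun_prop),
      lintegral_exp_inner_complexGaussian (hlam j), norm_mul, RCLike.norm_conj]
    ring_nf
  rw [h5, Finset.prod_congr rfl fun j _ => h6 j,
    ← ENNReal.ofReal_prod_of_nonneg fun _ _ => (Real.exp_pos _).le, ← Real.exp_sum,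
    Finset.mul_sum]

/-- Gaussian concentration of a linear combination of independent complex Gaussian variables. -/
theorem IsFreeGibbsMeasure.lintegral_exp_sq_sum_le (hμ : IsFreeGibbsMeasure lam μ)
    (hlam : ∀ n, 0 < lam n) (t : Finset ℕ) (c : ℕ → ℂ) {κ : ℝ} (hκ : 0 < κ)
    (hc : ∑ n ∈ t, ‖c n‖ ^ 2 / lam n ≤ κ) :
    ∫⁻ α, ENNReal.ofReal (Real.exp (‖∑ n ∈ t, c n * α n‖ ^ 2 / (2 * κ))) ∂μ ≤ 2 := by
  have := hμ.isProb
  have := isProbabilityMeasure_complexGaussian one_pos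
  set τ := √(2 * κ) with hτ
  have hτ0 : 0 < τ := Real.sqrt_pos.mpr (by positivity)
  have hτ2 : τ ^ 2 = 2 * κ := Real.sq_sqrt (by positivity)
  -- Linearization of the square: the exponential of `‖z‖²` is an average of exponentials of linear
  -- forms over an auxiliary standard Gaussian `w`. After exchanging the integrals, the Laplace
  -- transform in `α` leaves at most `exp (‖w‖² / 2)`.
  have h1 : ∀ z : ℂ, ENNReal.ofReal (Real.exp (‖z‖ ^ 2 / (2 * κ))) =
      ∫⁻ w, ENNReal.ofReal (Real.exp (2 * ⟪(τ⁻¹ : ℝ) • w, z⟫_ℝ)) ∂complexGaussian 1 := fun z => by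
    have := lintegral_exp_inner_complexGaussian one_pos ((τ⁻¹ : ℝ) • z)
    rw [norm_smul, mul_pow, norm_inv, Real.norm_of_nonneg hτ0.le, inv_pow, hτ2, div_one,
      inv_mul_eq_div] at this
    rw [← this]
    refine lintegral_congr fun w => ?_
    rw [real_inner_smul_left, real_inner_smul_left, real_inner_comm]
  simp_rw [h1]
  rw [lintegral_lintegral_swap (by fun_prop)]
  simp_rw [hμ.lintegral_exp_inner_sum hlam]
  rw [← lintegral_exp_half_sq_complexGaussian_one]
  refine lintegral_mono fun w => ENNReal.ofReal_le_ofReal (Real.exp_le_exp.mpr ?_)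
  rw [norm_smul, mul_pow, norm_inv, Real.norm_of_nonneg hτ0.le, inv_pow, hτ2]
  calc (2 * κ)⁻¹ * ‖w‖ ^ 2 * ∑ n ∈ t, ‖c n‖ ^ 2 / lam n ≤ (2 * κ)⁻¹ * ‖w‖ ^ 2 * κ := by gcongr
    _ = ‖w‖ ^ 2 / 2 := by field_simp

/-- `yᵖ ≤ pᵖ eʸ`. -/
theorem rpow_le_rpow_mul_exp {y p : ℝ} (hy : 0 ≤ y) (hp : 0 < p) :
    y ^ p ≤ p ^ p * Real.exp y := by
  have h1 : y / p ≤ Real.exp (y / p) := by linarith [Real.add_one_le_exp (y / p)]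
  have h2 : y ≤ p * Real.exp (y / p) := by
    calc y = p * (y / p) := by field_simp
      _ ≤ _ := by gcongr
  calc y ^ p ≤ (p * Real.exp (y / p)) ^ p := by gcongr
    _ = p ^ p * Real.exp y := by
      rw [Real.mul_rpow hp.le (Real.exp_pos _).le, ← Real.exp_mul, div_mul_cancel₀ _ hp.ne']

/-- Moments of a linear combination of independent complex Gaussian variables. -/
theorem IsFreeGibbsMeasure.lintegral_rpow_sum_le (hμ : IsFreeGibbsMeasure lam μ)
    (hlam : ∀ n, 0 < lam n) (t : Finset ℕ) (c : ℕ → ℂ) {p : ℝ} (hp : 0 < p) :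
    ∫⁻ α, ‖∑ n ∈ t, c n * α n‖ₑ ^ (2 * p) ∂μ ≤
      2 * ENNReal.ofReal ((2 * p) ^ p) * ENNReal.ofReal (∑ n ∈ t, ‖c n‖ ^ 2 / lam n) ^ p := by
  set κ := ∑ n ∈ t, ‖c n‖ ^ 2 / lam n with hκ
  have hnn : ∀ n ∈ t, 0 ≤ ‖c n‖ ^ 2 / lam n := fun n _ => div_nonneg (sq_nonneg _) (hlam n).le
  -- Zero variance is treated apart, because the concentration bound divides by `κ`.
  rcases (Finset.sum_nonneg hnn).eq_or_lt with h0 | h0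
  · have hz : ∀ n ∈ t, c n = 0 := fun n hn => by
      have := (Finset.sum_eq_zero_iff_of_nonneg hnn).mp h0.symm n hn
      simpa [(hlam n).ne'] using this
    have : ∀ α : ℕ → ℂ, ∑ n ∈ t, c n * α n = 0 := fun α =>
      Finset.sum_eq_zero fun n hn => by rw [hz n hn, zero_mul]
    simp [this, hp]
  · rw [← hκ] at h0
    have hb : ∀ z : ℂ, ‖z‖ₑ ^ (2 * p) ≤ ENNReal.ofReal ((2 * p) ^ p) * ENNReal.ofReal κ ^ p *
        ENNReal.ofReal (Real.exp (‖z‖ ^ 2 / (2 * κ))) := fun z => by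
      rw [ENNReal.ofReal_rpow_of_nonneg h0.le hp.le, ← ENNReal.ofReal_mul (by positivity),
        ← ENNReal.ofReal_mul (by positivity), ← ofReal_norm,
        ENNReal.ofReal_rpow_of_nonneg (norm_nonneg _) (by positivity)]
      refine ENNReal.ofReal_le_ofReal ?_
      have h1 := rpow_le_rpow_mul_exp (y := ‖z‖ ^ 2 / (2 * κ)) (by positivity) hp
      calc ‖z‖ ^ (2 * p) = (‖z‖ ^ 2) ^ p := by
            rw [Real.rpow_mul (norm_nonneg _)]; norm_num
        _ = (2 * κ) ^ p * (‖z‖ ^ 2 / (2 * κ)) ^ p := by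
            rw [← Real.mul_rpow (by positivity) (by positivity)]
            congr 1; field_simp
        _ ≤ (2 * κ) ^ p * (p ^ p * Real.exp (‖z‖ ^ 2 / (2 * κ))) := by gcongr
        _ = _ := by
            rw [Real.mul_rpow (by norm_num) h0.le, Real.mul_rpow (by norm_num) hp.le]; ring
    refine (lintegral_mono fun α => hb _).trans ?_
    rw [lintegral_const_mul _ (by fun_prop)]
    refine (mul_le_mul' le_rfl (hμ.lintegral_exp_sq_sum_le hlam t c h0 le_rfl)).trans ?_
    rw [mul_comm, mul_assoc]

end

/-! ### Moments of `L^{2p}` norms of Gaussian sums. -/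

/-- Orlicz-type bound: the exponential of the squared `L^{2p}` norm is controlled by an exponential
integral with weight `K ^ p`. -/
theorem exp_eLpNorm_sq_le {K : ℝ → ℝ} (hK : ∀ x, 0 < K x) {p : ℝ} (hp : 1 ≤ p)
    (hKm : Measurable K) (hKp : Integrable fun x => K x ^ p) {f : ℝ → ℂ} (hf : Measurable f) :
    ENNReal.ofReal (Real.exp ((4 * ((∫ x, K x ^ p) ^ p⁻¹ + p))⁻¹ *
        (eLpNorm f (ENNReal.ofReal (2 * p)) volume).toReal ^ 2)) ≤
      ENNReal.ofReal (Real.exp 1) *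
        (1 + ∫⁻ x, ENNReal.ofReal (Real.exp (‖f x‖ ^ 2 / (2 * K x)) * K x ^ p)) := by
  have hp0 : 0 < p := by linarith
  set A := ∫ x, K x ^ p with hA
  have hA0 : 0 ≤ A := integral_nonneg fun x => Real.rpow_nonneg (hK x).le _
  set M := ∫⁻ x, ENNReal.ofReal (Real.exp (‖f x‖ ^ 2 / (2 * K x)) * K x ^ p) with hM
  by_cases hMt : M = ⊤
  · rw [hMt, add_top, ENNReal.mul_top]
    · exact le_top
    · simp [Real.exp_pos]
  set m := M.toReal with hm
  have hm0 : 0 ≤ m := ENNReal.toReal_nonneg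
  have hMm : M = ENNReal.ofReal m := (ENNReal.ofReal_toReal hMt).symm
  -- The target is `‖f‖² ≲ 1 + l`. The factor `exp (-l) = 1 / (1 + m)` compensates the size `m` of
  -- the exponential integral.
  set l := Real.log (1 + m) with hl
  have hl0 : 0 ≤ l := Real.log_nonneg (by linarith)
  have hel : Real.exp l = 1 + m := Real.exp_log (by linarith)
  have hpt : ∀ x, ‖f x‖ ^ (2 * p) ≤ 4 ^ p * l ^ p * K x ^ p +
      4 ^ p * p ^ p / (1 + m) * (Real.exp (‖f x‖ ^ 2 / (2 * K x)) * K x ^ p) := fun x => by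
    have hKx := hK x
    have hKp0 : 0 < K x ^ p := Real.rpow_pos_of_pos hKx p
    set W := ‖f x‖ ^ 2 / K x with hW
    have hW0 : 0 ≤ W := by positivity
    have h1 : ‖f x‖ ^ (2 * p) = W ^ p * K x ^ p := by
      rw [← Real.mul_rpow hW0 hKx.le, hW, div_mul_cancel₀ _ hKx.ne',
        Real.rpow_mul (norm_nonneg _)]
      norm_num
    have h2 : ‖f x‖ ^ 2 / (2 * K x) = W / 2 := by rw [hW]; field_simp
    rw [h1, h2]
    have h3 : W ^ p ≤ 4 ^ p * l ^ p + 4 ^ p * p ^ p / (1 + m) * Real.exp (W / 2) := by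
      have hpos : 0 ≤ 4 ^ p * p ^ p / (1 + m) * Real.exp (W / 2) := by positivity
      have hpos' : 0 ≤ (4 : ℝ) ^ p * l ^ p := by positivity
      -- Above the threshold `4 * l` one has `W ≤ 4 * (W / 2 - l)`, and the power of `W / 2 - l` is
      -- absorbed by `exp (W / 2 - l)`.
      rcases le_total W (4 * l) with h | h
      · have : W ^ p ≤ (4 * l) ^ p := by gcongr
        rw [Real.mul_rpow (by norm_num) hl0] at this
        linarith
      · have hy : 0 ≤ W / 2 - l := by linarith
        have h4 : W ^ p ≤ (4 * (W / 2 - l)) ^ p := by gcongr; linarith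
        rw [Real.mul_rpow (by norm_num) hy] at h4
        have h5 := rpow_le_rpow_mul_exp hy hp0
        rw [Real.exp_sub, hel] at h5
        have h6 : (4 : ℝ) ^ p * (W / 2 - l) ^ p ≤
            4 ^ p * (p ^ p * (Real.exp (W / 2) / (1 + m))) := by gcongr
        have h7 : (4 : ℝ) ^ p * (p ^ p * (Real.exp (W / 2) / (1 + m))) =
            4 ^ p * p ^ p / (1 + m) * Real.exp (W / 2) := by ring
        linarith
    calc W ^ p * K x ^ p ≤
        (4 ^ p * l ^ p + 4 ^ p * p ^ p / (1 + m) * Real.exp (W / 2)) * K x ^ p := by gcongr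
      _ = _ := by ring
  set N := (eLpNorm f (ENNReal.ofReal (2 * p)) volume).toReal with hN
  have hint : ∫⁻ x, ‖f x‖ₑ ^ (2 * p) ≤ ENNReal.ofReal (4 ^ p * (l ^ p * A + p ^ p)) := by
    have hle : ∀ x, ‖f x‖ₑ ^ (2 * p) ≤ ENNReal.ofReal (4 ^ p * l ^ p) * ENNReal.ofReal (K x ^ p) +
        ENNReal.ofReal (4 ^ p * p ^ p / (1 + m)) *
          ENNReal.ofReal (Real.exp (‖f x‖ ^ 2 / (2 * K x)) * K x ^ p) := fun x => by
      have hKp0 : 0 < K x ^ p := Real.rpow_pos_of_pos (hK x) p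
      rw [← ENNReal.ofReal_mul (by positivity), ← ENNReal.ofReal_mul (by positivity),
        ← ENNReal.ofReal_add (by positivity) (by positivity), ← ofReal_norm,
        ENNReal.ofReal_rpow_of_nonneg (norm_nonneg _) (by positivity)]
      exact ENNReal.ofReal_le_ofReal (hpt x)
    refine (lintegral_mono hle).trans ?_
    rw [lintegral_add_left (by fun_prop), lintegral_const_mul _ (by fun_prop),
      lintegral_const_mul _ (by fun_prop), ← hM, hMm,
      ← ofReal_integral_eq_lintegral_ofReal hKp
        (Filter.Eventually.of_forall fun x => Real.rpow_nonneg (hK x).le _),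
      ← ENNReal.ofReal_mul (by positivity), ← ENNReal.ofReal_mul (by positivity),
      ← ENNReal.ofReal_add (by positivity) (by positivity)]
    refine ENNReal.ofReal_le_ofReal ?_
    have : 4 ^ p * p ^ p / (1 + m) * m ≤ 4 ^ p * p ^ p := by
      rw [div_mul_eq_mul_div, div_le_iff₀ (by linarith)]
      have : 0 ≤ (4 : ℝ) ^ p * p ^ p := by positivity
      nlinarith
    nlinarith
  have hApos : 0 ≤ A ^ p⁻¹ := by positivity
  -- Superadditivity of `y ↦ y ^ p` for `p ≥ 1` gathers the terms into one `p`-th power; this fixes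
  -- the constant in the exponent.
  have hD : 4 ^ p * (l ^ p * A + p ^ p) ≤ (4 * ((A ^ p⁻¹ + p) * (l + 1))) ^ p := by
    rw [Real.mul_rpow (by norm_num) (by positivity)]
    gcongr
    calc l ^ p * A + p ^ p = (A ^ p⁻¹ * l) ^ p + p ^ p := by
          rw [Real.mul_rpow hApos hl0, ← Real.rpow_mul hA0, inv_mul_cancel₀ hp0.ne',
            Real.rpow_one, mul_comm]
      _ ≤ (A ^ p⁻¹ * l + p) ^ p := Real.add_rpow_le_rpow_add (by positivity) hp0.le hp
      _ ≤ _ := by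
          gcongr
          nlinarith
  have hN2 : N ^ 2 ≤ 4 * ((A ^ p⁻¹ + p) * (l + 1)) := by
    have h1 : eLpNorm f (ENNReal.ofReal (2 * p)) volume ≤
        ENNReal.ofReal ((4 * ((A ^ p⁻¹ + p) * (l + 1))) ^ (2 : ℝ)⁻¹) := by
      rw [eLpNorm_eq_lintegral_rpow_enorm_toReal (by simpa using hp0) ENNReal.ofReal_ne_top,
        ENNReal.toReal_ofReal (by positivity)]
      refine (ENNReal.rpow_le_rpow (hint.trans (ENNReal.ofReal_le_ofReal hD))
        (by positivity)).trans (le_of_eq ?_)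
      rw [ENNReal.ofReal_rpow_of_nonneg (by positivity) (by positivity),
        ← Real.rpow_mul (by positivity)]
      congr 2
      field_simp
    have h2 : N ≤ (4 * ((A ^ p⁻¹ + p) * (l + 1))) ^ (2 : ℝ)⁻¹ :=
      ENNReal.toReal_le_of_le_ofReal (by positivity) h1
    calc N ^ 2 ≤ ((4 * ((A ^ p⁻¹ + p) * (l + 1))) ^ (2 : ℝ)⁻¹) ^ 2 := by
          gcongr
      _ = _ := by
          rw [← Real.rpow_natCast, ← Real.rpow_mul (by positivity)]
          norm_num
  have hfin : (4 * (A ^ p⁻¹ + p))⁻¹ * N ^ 2 ≤ 1 + l := by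
    rw [inv_mul_le_iff₀ (by positivity)]
    linarith
  rw [hMm, ← ENNReal.ofReal_one, ← ENNReal.ofReal_add (by norm_num) hm0,
    ← ENNReal.ofReal_mul (Real.exp_pos _).le, ← hel, ← Real.exp_add]
  exact ENNReal.ofReal_le_ofReal (Real.exp_le_exp.mpr hfin)

section

variable {V : ℝ → ℝ} {lam : ℕ → ℝ} {u : HilbertBasis ℕ ℂ L2} {e : ℕ → EnergySpace}

theorem measurable_basis (u : HilbertBasis ℕ ℂ L2) (n : ℕ) : Measurable (u n : ℝ → ℂ) :=
  (Lp.stronglyMeasurable (u n)).measurable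

/-- The eigenfunctions are in `L^r`, `r > 4 / s`. -/
theorem IsEigenSystem.memLp_basis (h : IsEigenSystem V lam u e) (hlam : ∀ n, 0 < lam n)
    {s C : ℝ} (hs : 0 < s) (hC : 0 < C) (hV : ∀ᵐ x : ℝ, C⁻¹ * |x| ^ s ≤ V x) {r : ℝ}
    (hr : 4 / s < r) (n : ℕ) : MemLp (u n) (ENNReal.ofReal r) := by
  have hr0 : 0 < r := lt_trans (by positivity) hr
  have hm := Lp.aestronglyMeasurable (u n)
  rw [← integrable_norm_rpow_iff hm (by simpa using hr0) ENNReal.ofReal_ne_top,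
    ENNReal.toReal_ofReal hr0.le]
  have hint := integrable_envelope_rpow (s := s) (p := r / 2) hC (by
    rw [div_lt_iff₀ hs] at hr; linarith)
  refine (hint.const_mul (lam n ^ (r / 2))).mono' (hm.norm.aemeasurable.pow_const _
    |>.aestronglyMeasurable) ?_
  filter_upwards [h.ae_sum_le_envelope hlam hs hC hV] with x hx
  -- A single term of the diagonal already gives `|uₙ|² ≤ λₙ K`.
  have h1 := hx {n}
  rw [Finset.sum_singleton, div_le_iff₀ (hlam n)] at h1
  rw [Real.norm_of_nonneg (by positivity), ← Real.mul_rpow (hlam n).le (envelope_pos hC x).le]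
  calc ‖u n x‖ ^ r = (‖u n x‖ ^ 2) ^ (r / 2) := by
        rw [← Real.rpow_natCast, ← Real.rpow_mul (norm_nonneg _)]
        congr 1; push_cast; ring
    _ ≤ _ := by
        have := hlam n
        gcongr
        linarith

theorem coeFn_sum_toLp {r : ℝ≥0∞} (hU : ∀ n, MemLp (u n) r volume) (t : Finset ℕ)
    (α : ℕ → ℂ) :
    ((∑ n ∈ t, α n • (hU n).toLp (u n) : Lp ℂ r (volume : Measure ℝ)) : ℝ → ℂ) =ᵐ[volume]
      fun x => ∑ n ∈ t, u n x * α n := by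
  have h1 : ∀ᵐ x, ∀ n, (α n • (hU n).toLp (u n) : Lp ℂ r (volume : Measure ℝ)) x = u n x * α n :=
    ae_all_iff.mpr fun n => by
      filter_upwards [Lp.coeFn_smul (α n) ((hU n).toLp (u n)), (hU n).coeFn_toLp] with x h1 h2
      rw [h1, Pi.smul_apply, h2, smul_eq_mul, mul_comm]
  filter_upwards [Lp.coeFn_fun_finsetSum t (fun n => α n • (hU n).toLp (u n)), h1] with x h2 h3
  rw [h2]
  exact Finset.sum_congr rfl fun n _ => h3 n

variable {μ : Measure (ℕ → ℂ)}

/-- Moments of the `L^{2p}` norm of Gaussian sums. -/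
theorem IsFreeGibbsMeasure.lintegral_eLpNorm_rpow_le (hμ : IsFreeGibbsMeasure lam μ)
    (hlam : ∀ n, 0 < lam n) (u : HilbertBasis ℕ ℂ L2) (t : Finset ℕ) {p : ℝ} (hp : 0 < p) :
    ∫⁻ α, eLpNorm (fun x => ∑ n ∈ t, u n x * α n) (ENNReal.ofReal (2 * p)) volume ^ (2 * p) ∂μ ≤
      2 * ENNReal.ofReal ((2 * p) ^ p) *
        ∫⁻ x, ENNReal.ofReal (∑ n ∈ t, ‖u n x‖ ^ 2 / lam n) ^ p := by
  have := hμ.isProb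
  have hum := measurable_basis u
  have h1 : ∀ α : ℕ → ℂ,
      eLpNorm (fun x => ∑ n ∈ t, u n x * α n) (ENNReal.ofReal (2 * p)) volume ^ (2 * p) =
        ∫⁻ x, ‖∑ n ∈ t, u n x * α n‖ₑ ^ (2 * p) := fun α => by
    rw [eLpNorm_eq_lintegral_rpow_enorm_toReal (by simpa using hp) ENNReal.ofReal_ne_top,
      ENNReal.toReal_ofReal (by positivity), ← ENNReal.rpow_mul, one_div,
      inv_mul_cancel₀ (by positivity), ENNReal.rpow_one]
  simp_rw [h1]
  rw [lintegral_lintegral_swap (by fun_prop), ← lintegral_const_mul _ (by fun_prop)]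
  exact lintegral_mono fun x => hμ.lintegral_rpow_sum_le hlam t (fun n => u n x) hp

/-- Exponential moments of the `L^{2p}` norm of Gaussian sums, uniformly in the sum. -/
theorem IsFreeGibbsMeasure.lintegral_exp_eLpNorm_le (hμ : IsFreeGibbsMeasure lam μ)
    (hlam : ∀ n, 0 < lam n) {K : ℝ → ℝ} (hK : ∀ x, 0 < K x) {p : ℝ} (hp : 1 ≤ p)
    (hKm : Measurable K) (hKp : Integrable fun x => K x ^ p)
    (hle : ∀ᵐ x, ∀ t : Finset ℕ, ∑ n ∈ t, ‖u n x‖ ^ 2 / lam n ≤ K x) (t : Finset ℕ) :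
    ∫⁻ α, ENNReal.ofReal (Real.exp ((4 * ((∫ x, K x ^ p) ^ p⁻¹ + p))⁻¹ *
        (eLpNorm (fun x => ∑ n ∈ t, u n x * α n) (ENNReal.ofReal (2 * p)) volume).toReal ^ 2)) ∂μ ≤
      ENNReal.ofReal (Real.exp 1) * (1 + 2 * ENNReal.ofReal (∫ x, K x ^ p)) := by
  have := hμ.isProb
  have hum := measurable_basis u
  refine (lintegral_mono fun α => exp_eLpNorm_sq_le hK hp hKm hKp (by fun_prop)).trans ?_
  rw [lintegral_const_mul' _ _ ENNReal.ofReal_ne_top, lintegral_add_left measurable_const,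
    lintegral_one, measure_univ, lintegral_lintegral_swap (by fun_prop)]
  gcongr
  rw [ofReal_integral_eq_lintegral_ofReal hKp
    (Filter.Eventually.of_forall fun x => Real.rpow_nonneg (hK x).le _),
    ← lintegral_const_mul _ (by fun_prop)]
  refine lintegral_mono_ae ?_
  filter_upwards [hle] with x hx
  simp_rw [ENNReal.ofReal_mul (Real.exp_pos _).le]
  rw [lintegral_mul_const _ (by fun_prop)]
  gcongr
  exact hμ.lintegral_exp_sq_sum_le hlam t (fun n => u n x) (hK x) (hx t)

/-- The `L^p` norms of the tails of the diagonal of the Green function tend to zero. -/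
theorem tendsto_lintegral_tail (u : HilbertBasis ℕ ℂ L2) (lam : ℕ → ℝ) {K : ℝ → ℝ} {p : ℝ}
    (hp : 0 < p) (hK : ∀ x, 0 < K x) (hKp : Integrable fun x => K x ^ p)
    (hle : ∀ᵐ x, greenDiag lam u x ≤ ENNReal.ofReal (K x)) :
    Filter.Tendsto (fun N => ∫⁻ x, (∑' n, ENNReal.ofReal (‖u (n + N) x‖ ^ 2 / lam (n + N))) ^ p)
      Filter.atTop (nhds 0) := by
  have hum := measurable_basis u
  have hz : ∫⁻ _ : ℝ, (0 : ℝ≥0∞) = 0 := lintegral_zero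
  rw [← hz]
  refine tendsto_lintegral_of_dominated_convergence (fun x => ENNReal.ofReal (K x) ^ p)
    (fun N => ?_) (fun N => ?_) ?_ ?_
  · refine Measurable.pow_const (Measurable.tsum fun n => ?_) _
    have := hum (n + N)
    fun_prop
  · filter_upwards [hle] with x hx
    refine ENNReal.rpow_le_rpow (le_trans ?_ hx) hp.le
    exact ENNReal.tsum_comp_le_tsum_of_injective (add_left_injective N) _
  · have : ∫⁻ x, ENNReal.ofReal (K x) ^ p = ENNReal.ofReal (∫ x, K x ^ p) := by
      rw [ofReal_integral_eq_lintegral_ofReal hKp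
        (Filter.Eventually.of_forall fun x => Real.rpow_nonneg (hK x).le _)]
      exact lintegral_congr fun x => ENNReal.ofReal_rpow_of_nonneg (hK x).le hp.le
    rw [this]; exact ENNReal.ofReal_ne_top
  · filter_upwards [hle] with x hx
    have h1 := ENNReal.tendsto_sum_nat_add (fun n => ENNReal.ofReal (‖u n x‖ ^ 2 / lam n))
      (hx.trans_lt ENNReal.ofReal_lt_top).ne
    have h2 := h1.ennrpow_const p
    rwa [ENNReal.zero_rpow_of_pos hp] at h2

end

/-! ### Almost sure convergence in `L^{2p}` and coefficients of the limit. -/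

section

variable {V : ℝ → ℝ} {lam : ℕ → ℝ} {u : HilbertBasis ℕ ℂ L2} {e : ℕ → EnergySpace}
  {μ : Measure (ℕ → ℂ)}

theorem enorm_sum_toLp {r : ℝ≥0∞} (hU : ∀ n, MemLp (u n) r volume) (t : Finset ℕ)
    (α : ℕ → ℂ) :
    ‖(∑ n ∈ t, α n • (hU n).toLp (u n) : Lp ℂ r (volume : Measure ℝ))‖ₑ =
      eLpNorm (fun x => ∑ n ∈ t, u n x * α n) r volume := by
  rw [Lp.enorm_def, eLpNorm_congr_ae (coeFn_sum_toLp hU t α)]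

/-- Along a subsequence, the Gaussian series converges almost surely in `L^{2p}`. -/
theorem IsFreeGibbsMeasure.exists_subseq_ae_tendsto (hμ : IsFreeGibbsMeasure lam μ)
    (hlam : ∀ n, 0 < lam n) {K : ℝ → ℝ} (hK : ∀ x, 0 < K x) {p : ℝ} (hp : 1 ≤ p)
    (hKp : Integrable fun x => K x ^ p) (hle : ∀ᵐ x, greenDiag lam u x ≤ ENNReal.ofReal (K x))
    [Fact (1 ≤ ENNReal.ofReal (2 * p))] (hU : ∀ n, MemLp (u n) (ENNReal.ofReal (2 * p)) volume) :
    ∃ φ : ℕ → ℕ, StrictMono φ ∧ ∀ᵐ α ∂μ, ∃ f : Lp ℂ (ENNReal.ofReal (2 * p)) (volume : Measure ℝ),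
      Filter.Tendsto (fun k => ∑ n ∈ Finset.range (φ k), α n • (hU n).toLp (u n)) Filter.atTop
        (nhds f) := by
  have hp0 : 0 < p := by linarith
  set c : ℝ≥0∞ := 2 * ENNReal.ofReal ((2 * p) ^ p) with hc
  have hct : c ≠ ⊤ := by finiteness
  let S : ℕ → (ℕ → ℂ) → Lp ℂ (ENNReal.ofReal (2 * p)) (volume : Measure ℝ) :=
    fun N α => ∑ n ∈ Finset.range N, α n • (hU n).toLp (u n)
  let T : ℕ → ℝ≥0∞ := fun N =>
    ∫⁻ x, (∑' n, ENNReal.ofReal (‖u (n + N) x‖ ^ 2 / lam (n + N))) ^ p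
  have hT : Filter.Tendsto (fun N => (c * T N) ^ (2 * p)⁻¹) Filter.atTop (nhds 0) := by
    have h1 := ENNReal.Tendsto.const_mul (tendsto_lintegral_tail u lam hp0 hK hKp hle)
      (Or.inr hct)
    have h2 := h1.ennrpow_const (2 * p)⁻¹
    rwa [mul_zero, ENNReal.zero_rpow_of_pos (by positivity)] at h2
  have hmeas : ∀ N, AEStronglyMeasurable (S N) μ := fun N => by
    have : Continuous (S N) := by
      refine continuous_finsetSum _ fun n _ => ?_
      fun_prop
    exact this.aestronglyMeasurable
  have hdiff : ∀ N a b, N ≤ a → a ≤ b →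
      eLpNorm (S b - S a) (ENNReal.ofReal (2 * p)) μ ≤ (c * T N) ^ (2 * p)⁻¹ := by
    intro N a b hNa hab
    rw [eLpNorm_eq_lintegral_rpow_enorm_toReal (by simpa using hp0) ENNReal.ofReal_ne_top,
      ENNReal.toReal_ofReal (by positivity), one_div]
    refine ENNReal.rpow_le_rpow ?_ (by positivity)
    have h1 : ∀ α, ‖(S b - S a) α‖ₑ ^ (2 * p) =
        eLpNorm (fun x => ∑ n ∈ Finset.Ico a b, u n x * α n) (ENNReal.ofReal (2 * p)) volume
          ^ (2 * p) := fun α => by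
      rw [Pi.sub_apply, ← enorm_sum_toLp hU, Finset.sum_Ico_eq_sub _ hab]
    simp_rw [h1]
    refine (hμ.lintegral_eLpNorm_rpow_le hlam u _ hp0).trans ?_
    rw [← hc]
    refine mul_le_mul' le_rfl (lintegral_mono fun x => ENNReal.rpow_le_rpow ?_ hp0.le)
    rw [ENNReal.ofReal_sum_of_nonneg fun n _ => div_nonneg (sq_nonneg _) (hlam n).le]
    -- Shifting indices by `N ≤ a` places the block inside the tail that starts at `N`.
    have hsub : Finset.Ico a b ⊆ (Finset.range (b - N)).map (addRightEmbedding N) := fun n hn => by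
      rw [Finset.mem_Ico] at hn
      rw [Finset.mem_map]
      exact ⟨n - N, by rw [Finset.mem_range]; omega, by simp; omega⟩
    refine (Finset.sum_le_sum_of_subset hsub).trans ?_
    rw [Finset.sum_map]
    exact ENNReal.sum_le_tsum _
  -- Geometric rates along the subsequence are summable, which upgrades Cauchy in mean to almost
  -- sure convergence.
  obtain ⟨φ, hφ, hφT⟩ := Filter.extraction_forall_of_eventually
    (P := fun k N => (c * T N) ^ (2 * p)⁻¹ < (2⁻¹ : ℝ≥0∞) ^ k)
    (fun k => hT.eventually_lt_const (by
      exact ENNReal.pow_pos (by norm_num) k))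
  refine ⟨φ, hφ, ?_⟩
  refine Lp.ae_tendsto_of_cauchy_eLpNorm (f := fun k => S (φ k)) (p := ENNReal.ofReal (2 * p))
    (B := fun k => (2⁻¹ : ℝ≥0∞) ^ k) (fun k => hmeas _) (Fact.out) ?_ ?_
  · rw [ENNReal.tsum_geometric]
    simp
  · intro k n m hn hm
    refine lt_of_le_of_lt ?_ (hφT k)
    rcases le_total n m with h | h
    · rw [eLpNorm_sub_comm]
      exact hdiff _ _ _ (hφ.monotone hn) (hφ.monotone h)
    · exact hdiff _ _ _ (hφ.monotone hm) (hφ.monotone h)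

theorem integral_conj_basis_mul (u : HilbertBasis ℕ ℂ L2) (m n : ℕ) :
    ∫ x, conj (u m x) * u n x = if m = n then 1 else 0 := by
  have h := orthonormal_iff_ite.mp u.orthonormal m n
  rw [L2.inner_def] at h
  simpa only [RCLike.inner_apply'] using h

/-- The limit of the Gaussian series has the right coefficients. -/
theorem hasCoeffs_of_tendsto {q r : ℝ≥0∞} [ENNReal.HolderConjugate q r] [Fact (1 ≤ r)]
    (hUq : ∀ n, MemLp (u n) q volume) (hU : ∀ n, MemLp (u n) r volume) {φ : ℕ → ℕ}
    (hφ : StrictMono φ) {α : ℕ → ℂ} {f : Lp ℂ r (volume : Measure ℝ)}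
    (hf : Filter.Tendsto (fun k => ∑ n ∈ Finset.range (φ k), α n • (hU n).toLp (u n)) Filter.atTop
        (nhds f)) : HasCoeffs u f α := by
  intro m
  refine ⟨integrable_conj_mul (hUq m) (Lp.memLp f), ?_⟩
  set S : ℕ → Lp ℂ r (volume : Measure ℝ) :=
    fun k => ∑ n ∈ Finset.range (φ k), α n • (hU n).toLp (u n) with hS
  -- Partial sums have the exact `m`-th coefficient once they contain the index `m`; Hölder's
  -- inequality carries this to the limit.
  have hcoef : ∀ k, m < φ k → ∫ x, conj (u m x) * S k x = α m := fun k hk => by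
    have h1 : ∫ x, conj (u m x) * S k x =
        ∫ x, ∑ n ∈ Finset.range (φ k), α n * (conj (u m x) * u n x) := by
      apply integral_congr_ae
      filter_upwards [coeFn_sum_toLp hU (Finset.range (φ k)) α] with x hx
      rw [hS, hx, Finset.mul_sum]
      exact Finset.sum_congr rfl fun n _ => by ring
    rw [h1, integral_finsetSum _ fun n _ => (integrable_conj_mul (hUq m) (hU n)).const_mul _]
    simp_rw [integral_const_mul, integral_conj_basis_mul]
    simp [hk]
  have hbound : ∀ k, m < φ k → ‖(∫ x, conj (u m x) * f x) - α m‖ₑ ≤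
      eLpNorm (u m) q volume * ‖f - S k‖ₑ := fun k hk => by
    rw [← hcoef k hk, ← integral_sub (integrable_conj_mul (hUq m) (Lp.memLp f))
      (integrable_conj_mul (hUq m) (Lp.memLp (S k)))]
    have h1 : ∫ x, (conj (u m x) * f x - conj (u m x) * S k x) =
        ∫ x, conj (u m x) * (f - S k : Lp ℂ r (volume : Measure ℝ)) x := by
      apply integral_congr_ae
      filter_upwards [Lp.coeFn_sub f (S k)] with x hx
      rw [hx, Pi.sub_apply, mul_sub]
    rw [h1, Lp.enorm_def]
    exact enorm_integral_conj_mul_le (hUq m).1 (Lp.aestronglyMeasurable _)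
  have hlim : Filter.Tendsto (fun k => eLpNorm (u m) q volume * ‖f - S k‖ₑ) Filter.atTop
      (nhds 0) := by
    have h2 := ((tendsto_const_nhds (x := f)).sub hf).enorm
    rw [sub_self, enorm_zero] at h2
    have h3 := ENNReal.Tendsto.const_mul h2 (Or.inr (hUq m).2.ne)
    rwa [mul_zero] at h3
  have h0 : ‖(∫ x, conj (u m x) * f x) - α m‖ₑ ≤ 0 := by
    refine ge_of_tendsto hlim ?_
    filter_upwards [Filter.eventually_gt_atTop m] with k hk
    exact hbound k (hk.trans_le hφ.le_apply)
  rw [nonpos_iff_eq_zero, enorm_eq_zero, sub_eq_zero] at h0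
  exact h0

/-- An element of `L^r`, `r > 2`, is determined by its coefficients. -/
theorem IsEigenSystem.eq_of_hasCoeffs (h : IsEigenSystem V lam u e) {s C : ℝ} (hs : 1 < s)
    (hC : 0 < C) (hV : ∀ᵐ x : ℝ, C⁻¹ * |x| ^ s ≤ V x) {q r : ℝ} (hqr : q.HolderConjugate r)
    (hr : 2 < r) {α : ℕ → ℂ} {f g : Lp ℂ (ENNReal.ofReal r) (volume : Measure ℝ)}
    (hf : HasCoeffs u f α) (hg : HasCoeffs u g α) : f = g := by
  have hz := h.ae_eq_zero hs hC hV hqr hr (d := (f : ℝ → ℂ) - g) ((Lp.memLp f).sub (Lp.memLp g))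
    (fun n => by
      simp only [Pi.sub_apply, mul_sub]
      exact (hf n).1.sub (hg n).1)
    (fun n => by
      simp only [Pi.sub_apply, mul_sub]
      rw [integral_sub (hf n).1 (hg n).1, (hf n).2, (hg n).2, sub_self])
  apply Lp.ext
  filter_upwards [hz] with x hx
  simpa [sub_eq_zero] using hx

theorem toLr_eq {r : ℝ} {α : ℕ → ℂ} {f : Lp ℂ (ENNReal.ofReal r) (volume : Measure ℝ)}
    (hf : HasCoeffs u f α)
    (huniq : ∀ g : Lp ℂ (ENNReal.ofReal r) (volume : Measure ℝ), HasCoeffs u g α → g = f) :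
    toLr u r α = f := by
  have hex : ∃ f : Lp ℂ (ENNReal.ofReal r) (volume : Measure ℝ), HasCoeffs u f α := ⟨f, hf⟩
  rw [toLr, dif_pos hex]
  exact huniq _ hex.choose_spec

/-! ### Support and exponential integrability of the Gaussian measure. -/

/-- The Gaussian measure is supported on `L^{2p}`, with exponential moments of the squared norm. -/
theorem IsEigenSystem.gaussian_supported (h : IsEigenSystem V lam u e) {s C : ℝ} (hs : 1 < s)
    (hC : 0 < C) (hV : ∀ᵐ x : ℝ, C⁻¹ * |x| ^ s ≤ V x) (hlam : ∀ n, 0 < lam n)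
    (hμ : IsFreeGibbsMeasure lam μ) {p : ℝ} (hp : 1 < p) (hps : 2 / s < p) :
    (∀ᵐ α ∂μ, ∃! f : Lp ℂ (ENNReal.ofReal (2 * p)) (volume : Measure ℝ), HasCoeffs u f α) ∧
      ∃ a : ℝ, 0 < a ∧ Integrable (fun α => Real.exp (a * ‖toLr u (2 * p) α‖ ^ 2)) μ := by
  have hs0 : 0 < s := by linarith
  have hr : 2 < 2 * p := by linarith
  have : Fact (1 ≤ ENNReal.ofReal (2 * p)) := ⟨by
    rw [← ENNReal.ofReal_one]; exact ENNReal.ofReal_le_ofReal (by linarith)⟩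
  have hqr : (2 * p).conjExponent.HolderConjugate (2 * p) :=
    (Real.HolderConjugate.conjExponent (by linarith)).symm
  set q := (2 * p).conjExponent with hq
  have : ENNReal.HolderConjugate (ENNReal.ofReal q) (ENNReal.ofReal (2 * p)) := hqr.ennrealOfReal
  have hq2 : q ≤ 2 := by
    have h1 := hqr.inv_add_inv_eq_one
    have h2 : (2 * p)⁻¹ < 2⁻¹ := inv_strictAnti₀ (by norm_num) hr
    exact (inv_le_inv₀ (by norm_num) hqr.pos).mp (by linarith)
  have hUq : ∀ n, MemLp (u n) (ENNReal.ofReal q) volume := fun n =>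
    memLp_of_mem_energyGraph hs hC hV hqr.lt.le hq2 (h.mem n)
  have hU : ∀ n, MemLp (u n) (ENNReal.ofReal (2 * p)) volume := fun n =>
    h.memLp_basis hlam hs0 hC hV (by
      have : 4 / s = 2 * (2 / s) := by ring
      linarith) n
  have hK := envelope_pos (s := s) hC
  have hKp : Integrable fun x => envelope s C x ^ p := integrable_envelope_rpow hC (by
    rw [div_lt_iff₀ hs0] at hps; linarith)
  obtain ⟨φ, hφ, hlim⟩ := hμ.exists_subseq_ae_tendsto hlam hK hp.le hKp
    (h.ae_greenDiag_le hlam hs0 hC hV) hU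
  have huniq : ∀ {α : ℕ → ℂ} {f g : Lp ℂ (ENNReal.ofReal (2 * p)) (volume : Measure ℝ)},
      HasCoeffs u f α → HasCoeffs u g α → f = g := fun hf hg =>
    h.eq_of_hasCoeffs hs hC hV hqr hr hf hg
  refine ⟨?_, ?_⟩
  · filter_upwards [hlim] with α ⟨f, hf⟩
    have hfc := hasCoeffs_of_tendsto hUq hU hφ hf
    exact ⟨f, hfc, fun g hg => huniq hg hfc⟩
  set a := (4 * ((∫ x, envelope s C x ^ p) ^ p⁻¹ + p))⁻¹ with ha
  have hA0 : 0 ≤ ∫ x, envelope s C x ^ p := integral_nonneg fun x => Real.rpow_nonneg (hK x).le _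
  have ha0 : 0 < a := by positivity
  refine ⟨a, ha0, ?_⟩
  let F : ℕ → (ℕ → ℂ) → ℝ := fun k α => Real.exp (a *
    ‖(∑ n ∈ Finset.range (φ k), α n • (hU n).toLp (u n) :
      Lp ℂ (ENNReal.ofReal (2 * p)) (volume : Measure ℝ))‖ ^ 2)
  have hFc : ∀ k, Continuous (F k) := fun k => by
    have : Continuous fun α : ℕ → ℂ => (∑ n ∈ Finset.range (φ k), α n • (hU n).toLp (u n) :
        Lp ℂ (ENNReal.ofReal (2 * p)) (volume : Measure ℝ)) := by
      refine continuous_finsetSum _ fun n _ => ?_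
      fun_prop
    exact Real.continuous_exp.comp (continuous_const.mul (this.norm.pow 2))
  have hFlim : ∀ᵐ α ∂μ, Filter.Tendsto (fun k => F k α) Filter.atTop
      (nhds (Real.exp (a * ‖toLr u (2 * p) α‖ ^ 2))) := by
    filter_upwards [hlim] with α ⟨f, hf⟩
    have hfc := hasCoeffs_of_tendsto hUq hU hφ hf
    rw [toLr_eq hfc fun g hg => huniq hg hfc]
    exact (Real.continuous_exp.tendsto _).comp ((hf.norm.pow 2).const_mul a)
  have hFb : ∀ k, ∫⁻ α, ENNReal.ofReal (F k α) ∂μ ≤ ENNReal.ofReal (Real.exp 1) *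
      (1 + 2 * ENNReal.ofReal (∫ x, envelope s C x ^ p)) := fun k => by
    have h1 := hμ.lintegral_exp_eLpNorm_le hlam hK hp.le (continuous_envelope s C).measurable hKp
      (h.ae_sum_le_envelope hlam hs0 hC hV) (Finset.range (φ k))
    refine le_trans (le_of_eq (lintegral_congr fun α => ?_)) h1
    rw [← enorm_sum_toLp hU, toReal_enorm]
  -- `toLr` is defined by choice, so measurability is obtained from the almost sure limit of
  -- continuous functions of `α`.
  refine ⟨aestronglyMeasurable_of_tendsto_ae Filter.atTop
    (fun k => (hFc k).aestronglyMeasurable) hFlim, ?_⟩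
  rw [hasFiniteIntegral_iff_ofReal (Filter.Eventually.of_forall fun α => (Real.exp_pos _).le)]
  -- Rewriting the limit as a lower limit prepares Fatou's lemma, with the bound uniform in `k`.
  have hliminf : ∫⁻ α, ENNReal.ofReal (Real.exp (a * ‖toLr u (2 * p) α‖ ^ 2)) ∂μ =
      ∫⁻ α, Filter.liminf (fun k => ENNReal.ofReal (F k α)) Filter.atTop ∂μ := by
    refine lintegral_congr_ae ?_
    filter_upwards [hFlim] with α hα
    exact ((ENNReal.continuous_ofReal.tendsto _).comp hα).liminf_eq.symm
  rw [hliminf]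
  refine (lintegral_liminf_le fun k => (hFc k).measurable.ennreal_ofReal).trans_lt ?_
  refine lt_of_le_of_lt (Filter.liminf_le_of_le (by isBoundedDefault) fun b hb => ?_)
    (b := ENNReal.ofReal (Real.exp 1) * (1 + 2 * ENNReal.ofReal (∫ x, envelope s C x ^ p)))
    (by finiteness)
  obtain ⟨k, hk⟩ := hb.exists
  exact hk.trans (hFb k)

end

end FreeGibbs

end

theorem mainTheorem3 (V : ℝ → ℝ) (s C : ℝ) (hs : 1 < s) (hC : 0 < C)
    (hVm : AEMeasurable V volume) (hV : ∀ᵐ x : ℝ, C⁻¹ * |x| ^ s ≤ V x)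
    (lam : ℕ → ℝ) (u : HilbertBasis ℕ ℂ FreeGibbs.L2)
    (hu : FreeGibbs.IsSpectralDecomposition V lam u)
    (μ₀ : Measure (ℕ → ℂ)) (hμ₀ : FreeGibbs.IsFreeGibbsMeasure lam μ₀) :
    (∀ r : ℝ, max 2 (4 / s) < r →
      (∀ᵐ α ∂μ₀, ∃! f : Lp ℂ (ENNReal.ofReal r) (volume : Measure ℝ),
        FreeGibbs.HasCoeffs u f α) ∧
      ∃ a : ℝ, 0 < a ∧
        Integrable (fun α => Real.exp (a * ‖FreeGibbs.toLr u r α‖ ^ 2)) μ₀) ∧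
    (∀ p : ℝ≥0∞, ENNReal.ofReal (max 1 (2 / s)) < p →
      MemLp (FreeGibbs.greenDiag lam u) p (volume : Measure ℝ)) := by
  have hs0 : 0 < s := by linarith
  -- The lower bound on `V` degenerates only at the origin, a null set.
  have hVpos : ∀ᵐ x, 0 < V x := by
    filter_upwards [hV, Measure.ae_ne volume (0 : ℝ)] with x hx hx0
    have : 0 < C⁻¹ * |x| ^ s :=
      mul_pos (inv_pos.mpr hC) (Real.rpow_pos_of_pos (abs_pos.mpr hx0) s)
    linarith
  obtain ⟨e, he⟩ := hu.exists_isEigenSystem hVm (hVpos.mono fun x hx => hx.le)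
  have hlam := he.lam_pos hVpos
  refine ⟨fun r hr => ?_, fun p hp => ?_⟩
  · obtain ⟨p, rfl⟩ : ∃ p, r = 2 * p := ⟨r / 2, by ring⟩
    rw [max_lt_iff] at hr
    refine he.gaussian_supported hs hC hV hlam hμ₀ (by linarith [hr.1]) ?_
    have : 4 / s = 2 * (2 / s) := by ring
    linarith [hr.2]
  · exact he.memLp_greenDiag hlam hs0 hC hV
      ((ENNReal.ofReal_le_ofReal (le_max_right _ _)).trans_lt hp)
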